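/- Let $G$ be a (finite-dimensional, real) Lie group with Lie algebra $\mathfrak g=T_1G$. For $p\ge 0$ let $\Delta^p=\{(x_0,\dots,x_p)\in\mathbb R^{p+1}:\sum_i x_i=1,\ x_i\ge 0\}$. A *left-invariant notion of simplices* in $G$ is a collection of smooth maps $\varphi_p:\Delta^p\times G^{p+1}\to G$, $p\ge 0$, written $[g_0,\dots,g_p]=\varphi_p(\,\cdot\,,g_0,\dots,g_p):\Delta^p\to G$, such that 1. $[g_0,\dots,g_p]$ sends the vertices of $\Delta^p$ to $g_0,\dots,g_p$, in that order; 2. $g\,[g_0,\dots,g_p]=[gg_0,\dots,gg_p]$ for all $g,g_0,\dots,g_p\in G$; 3. for $p\ge 1$ the restriction of $[g_0,\dots,g_p]$ to the $i$-th face of $\Delta^p$ is the $(p-1)$-simplex $[g_0,\dots,\widehat{g_i},\dots,g_p]$. Let $C^\bullet(\mathfrak g)$ be the Lie algebra cochain complex: $C^p(\mathfrak g)$ is the space of alternating $p$-linear maps $\mathfrak g^p\to\mathbb R$, with the differential $$d\omega(X_0,\dots,X_p)=\sum_{0\le i<j\le p}(-1)^{i+j}\,\omega([X_i,X_j],X_0,\dots,\widehat{X_i},\dots,\widehat{X_j},\dots,X_p).$$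 Each $\omega\in C^p(\mathfrak g)$ is identified with the left-invariant $p$-form on $G$ whose value at the identity is $\omega$. Let $C^\bullet(G)$ be the Lie group cochain complex: $C^p(G)$ is the space of smooth functions $F:G^{p+1}\to\mathbb R$ that are homogeneous, i.e. $F(gg_0,\dots,gg_p)=F(g_0,\dots,g_p)$, with the differential $$dF(g_0,\dots,g_{p+1})=\sum_{i=0}^{p+1}(-1)^iF(g_0,\dots,\widehat{g_i},\dots,g_{p+1}).$$ Suppose that $G$ is equipped with a left-invariant notion of simplices. Then integration defines a cochain map $$\textstyle\int:C^\bullet(\mathfrak g)\to C^\bullet(G),\qquad \left(\int\omega\right)(g_0,\dots,g_p)=\displaystyle\int_{[g_0,\dots,g_p]}\omega .$$ That is, for every $p\ge 0$ and $\omega\in C^p(\mathfrak g)$ the integral exists for all $g_0,\dots,g_p\in G$ ($\Delta^p$ carrying the standard orientation given by $e_1-e_0,\dots,e_p-e_0$), the function $\int\omega$ is smooth and homogeneous, it depends linearly on $\omega$, and $\int d\omega=d\int\omega$. -/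

import Mathlib

open scoped Manifold ContDiff

/-! ### The cochain complex of a Lie algebra -/

section LieAlgebraCochains

variable {L : Type*} [LieRing L]

/-- The Chevalley--Eilenberg expression
`∑_{i < j} (-1)^j F(X_0, …, [X_i, X_j], …, X̂_j, …, X_p)`, the bracket standing in slot `i`.
For alternating `F`, moving the bracket to the front costs the sign `(-1)^i` and gives the usual
`∑_{i < j} (-1)^(i+j) F([X_i, X_j], X_0, …, X̂_i, …, X̂_j, …, X_p)`. -/
noncomputable def ceSum {p : ℕ} (F : (Fin p → L) → ℝ) (X : Fin (p + 1) → L) : ℝ :=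
  ∑ i : Fin (p + 1), ∑ j ∈ Finset.Ioi i,
    (-1) ^ (j : ℕ) * F (j.removeNth (Function.update X i ⁅X i, X j⁆))

theorem ceSum_eq_ite {p : ℕ} (F : (Fin p → L) → ℝ) (X : Fin (p + 1) → L) :
    ceSum F X = ∑ j : Fin (p + 1), ∑ i : Fin (p + 1), if i < j then
      (-1) ^ (j : ℕ) * F (j.removeNth (Function.update X i ⁅X i, X j⁆)) else 0 := by
  rw [Finset.sum_comm, ceSum]
  refine Finset.sum_congr rfl fun i _ => ?_
  rw [← Finset.sum_filter]
  refine Finset.sum_congr ?_ fun _ _ => rfl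
  ext; simp

theorem ceSum_add {p : ℕ} (F F' : (Fin p → L) → ℝ) (c : ℝ) :
    ceSum (F + c • F') = ceSum F + c • ceSum F' := by
  funext X
  simp only [ceSum, Pi.add_apply, Pi.smul_apply, smul_eq_mul, Finset.mul_sum,
    ← Finset.sum_add_distrib]
  refine Finset.sum_congr rfl fun i _ => Finset.sum_congr rfl fun j _ => by ring

/-- `(R_X F)(Y) = ∑_k F(Y_0, …, [Y_k, X], …, Y_{p-1})`. -/
def ceAct {p : ℕ} (X : L) (F : (Fin p → L) → ℝ) (Y : Fin p → L) : ℝ :=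
  ∑ k, F (Function.update Y k ⁅Y k, X⁆)

theorem ceAct_add {p : ℕ} (X : L) (F F' : (Fin p → L) → ℝ) (c : ℝ) :
    ceAct X (F + c • F') = ceAct X F + c • ceAct X F' := by
  funext Y
  simp [ceAct, Finset.mul_sum, Finset.sum_add_distrib]

theorem ceSum_snoc {p : ℕ} (F : (Fin (p + 1) → L) → ℝ) (Y : Fin (p + 1) → L) (Z : L) :
    ceSum F (Fin.snoc (α := fun _ => L) Y Z) =
      ceSum (fun V : Fin p → L => F (Fin.snoc (α := fun _ => L) V Z)) Y
        + (-1) ^ (p + 1) * ceAct Z F Y := by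
  rw [ceSum_eq_ite, Fin.sum_univ_castSucc]
  congr 1
  · rw [ceSum_eq_ite]
    refine Finset.sum_congr rfl fun j _ => ?_
    rw [Fin.sum_univ_castSucc, if_neg (not_lt.2 (Fin.castSucc_lt_last j).le), add_zero]
    refine Finset.sum_congr rfl fun i _ => ?_
    simp only [Fin.castSucc_lt_castSucc_iff, Fin.snoc_castSucc, Fin.val_castSucc]
    congr 3
    rw [← Fin.snoc_update]
    funext k
    refine Fin.lastCases ?_ (fun k => ?_) k
    · rw [Fin.removeNth_apply, Fin.succAbove_ne_last_last (Fin.castSucc_lt_last j).ne, Fin.snoc_last, Fin.snoc_last]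
    · rw [Fin.removeNth_apply, Fin.castSucc_succAbove_castSucc, Fin.snoc_castSucc, Fin.snoc_castSucc,
        Fin.removeNth_apply]
  · rw [Fin.sum_univ_castSucc]
    simp only [lt_irrefl, if_false, add_zero, Fin.castSucc_lt_last, if_true, Fin.snoc_castSucc,
      Fin.snoc_last, ceAct, Finset.mul_sum, Fin.val_last]
    refine Finset.sum_congr rfl fun i _ => ?_
    rw [← Fin.snoc_update, Fin.removeNth_last, Fin.init_snoc]

theorem ceSum_zero_left (F : (Fin 0 → L) → ℝ) : ceSum F = 0 := by
  funext X
  simp [ceSum_eq_ite]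

theorem ceAct_snoc {p : ℕ} (F : (Fin (p + 1) → L) → ℝ) (X Z : L) (Y : Fin p → L) :
    ceAct X F (Fin.snoc (α := fun _ => L) Y Z) =
      ceAct X (fun V : Fin p → L => F (Fin.snoc (α := fun _ => L) V Z)) Y
        + F (Fin.snoc (α := fun _ => L) Y ⁅Z, X⁆) := by
  rw [ceAct, Fin.sum_univ_castSucc]
  simp only [Fin.snoc_castSucc, Fin.snoc_last, ← Fin.snoc_update, Fin.update_snoc_last, ceAct]

/-- Additivity in each slot. -/
def SlotAdditive {p : ℕ} (F : (Fin p → L) → ℝ) : Prop :=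
  ∀ (Y : Fin p → L) (i : Fin p) (x y : L),
    F (Function.update Y i (x + y)) = F (Function.update Y i x) + F (Function.update Y i y)

theorem SlotAdditive.snoc {p : ℕ} {F : (Fin (p + 1) → L) → ℝ} (hF : SlotAdditive F) (Z : L) :
    SlotAdditive (fun V : Fin p → L => F (Fin.snoc (α := fun _ => L) V Z)) := by
  intro Y i x y
  simp only [Fin.snoc_update]
  exact hF _ _ _ _

theorem ceAct_comm {p : ℕ} {F : (Fin p → L) → ℝ} (hF : SlotAdditive F) (X Z : L)
    (Y : Fin p → L) :
    ceAct Z (ceAct X F) Y = ceAct X (ceAct Z F) Y + ceAct ⁅Z, X⁆ F Y := by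
  have split : ∀ A B : L, ceAct A (ceAct B F) Y =
      (∑ i, ∑ k, if k = i then 0 else
        F (Function.update (Function.update Y i ⁅Y i, A⁆) k ⁅Y k, B⁆))
      + ∑ i, F (Function.update Y i ⁅⁅Y i, A⁆, B⁆) := by
    intro A B
    rw [ceAct, ← Finset.sum_add_distrib]
    refine Finset.sum_congr rfl fun i _ => ?_
    rw [ceAct, ← Finset.add_sum_erase _ _ (Finset.mem_univ i), add_comm]
    congr 1
    · rw [← Finset.add_sum_erase (Finset.univ) (fun k => if k = i then (0 : ℝ) else _)
        (Finset.mem_univ i)]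
      simp only [if_true, zero_add]
      refine Finset.sum_congr rfl fun k hk => ?_
      rw [if_neg (Finset.ne_of_mem_erase hk),
        Function.update_of_ne (Finset.ne_of_mem_erase hk)]
    · simp
  rw [split, split, add_assoc]
  congr 1
  · rw [Finset.sum_comm]
    refine Finset.sum_congr rfl fun i _ => Finset.sum_congr rfl fun k _ => ?_
    by_cases h : i = k
    · simp [h]
    · rw [if_neg h, if_neg (Ne.symm h), Function.update_comm (Ne.symm h)]
  · rw [ceAct, ← Finset.sum_add_distrib]
    refine Finset.sum_congr rfl fun i _ => ?_
    rw [← hF, lie_lie (Y i) Z X, ← lie_skew ⁅Y i, X⁆ Z, neg_add_eq_sub]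

theorem ceSum_ceAct : ∀ {p : ℕ} {F : (Fin p → L) → ℝ} (_ : SlotAdditive F) (X : L),
    ceSum (ceAct X F) = ceAct X (ceSum F)
  | 0, F, _, X => by
    rw [ceSum_zero_left, ceSum_zero_left]
    funext Y
    simp [ceAct]
  | p + 1, F, hF, X => by
    funext V
    obtain ⟨Y, Z, rfl⟩ : ∃ (Y : Fin (p + 1) → L) (Z : L),
        V = Fin.snoc (α := fun _ => L) Y Z := ⟨Fin.init V, V (Fin.last _), by simp⟩
    have h1 : (fun V : Fin p → L => ceAct X F (Fin.snoc (α := fun _ => L) V Z)) =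
        ceAct X (fun V : Fin p → L => F (Fin.snoc (α := fun _ => L) V Z)) +
          (1 : ℝ) • (fun V : Fin p → L => F (Fin.snoc (α := fun _ => L) V ⁅Z, X⁆)) := by
      funext V
      simp [ceAct_snoc]
    have h2 : (fun V : Fin (p + 1) → L => ceSum F (Fin.snoc (α := fun _ => L) V Z)) =
        ceSum (fun V : Fin p → L => F (Fin.snoc (α := fun _ => L) V Z)) +
          ((-1) ^ (p + 1) : ℝ) • ceAct Z F := by
      funext V
      simp [ceSum_snoc]
    rw [ceSum_snoc, h1, ceSum_add, ceAct_snoc, h2, ceAct_add, ceSum_snoc,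
      ceSum_ceAct (hF.snoc Z) X]
    simp only [Pi.add_apply, Pi.smul_apply, smul_eq_mul]
    rw [ceAct_comm hF X Z Y]
    ring

theorem ceSum_ceSum : ∀ {p : ℕ} {F : (Fin p → L) → ℝ} (_ : SlotAdditive F),
    ceSum (ceSum F) = 0
  | 0, F, _ => by
    rw [ceSum_zero_left]
    funext X
    simp [ceSum]
  | p + 1, F, hF => by
    funext V
    obtain ⟨Y, Z, rfl⟩ : ∃ (Y : Fin (p + 2) → L) (Z : L),
        V = Fin.snoc (α := fun _ => L) Y Z := ⟨Fin.init V, V (Fin.last _), by simp⟩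
    have h2 : (fun V : Fin (p + 1) → L => ceSum F (Fin.snoc (α := fun _ => L) V Z)) =
        ceSum (fun V : Fin p → L => F (Fin.snoc (α := fun _ => L) V Z)) +
          ((-1) ^ (p + 1) : ℝ) • ceAct Z F := by
      funext V
      simp [ceSum_snoc]
    rw [ceSum_snoc, h2, ceSum_add, ceSum_ceSum (hF.snoc Z), ceSum_ceAct hF]
    simp only [Pi.add_apply, Pi.smul_apply, smul_eq_mul, Pi.zero_apply]
    ring

variable [LieAlgebra ℝ L]

/-- The `p`-cochains of a real Lie algebra: alternating `p`-linear maps to `ℝ`. -/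
abbrev LieCochain (L : Type*) [LieRing L] [LieAlgebra ℝ L] (p : ℕ) : Type _ :=
  L [⋀^Fin p]→ₗ[ℝ] ℝ

theorem lieDerivAux_term {p : ℕ} (η : LieCochain L p) (X : L) (Y : Fin p → L) (k : Fin p) :
    (η.toMultilinearMap.compLinearMap (Function.update (fun _ => LinearMap.id) k
      (LieAlgebra.ad ℝ L X))) Y = η (Function.update Y k ⁅X, Y k⁆) := by
  simp only [MultilinearMap.compLinearMap_apply]
  refine congrArg η ?_
  funext i
  by_cases hik : i = k
  · subst hik; simp
  · simp [hik]

/-- The map sending `X` to the alternating map `Y ↦ ∑_k η(Y_0, …, [X, Y_k], …, Y_{p-1})`. -/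
noncomputable def lieDerivAux {p : ℕ} (η : LieCochain L p) : L →ₗ[ℝ] LieCochain L p where
  toFun X :=
    { toMultilinearMap := ∑ k : Fin p, η.toMultilinearMap.compLinearMap
        (Function.update (fun _ => LinearMap.id) k (LieAlgebra.ad ℝ L X))
      map_eq_zero_of_eq' := by
        intro Y a b hab hne
        simp only [MultilinearMap.toFun_eq_coe, sum_apply, lieDerivAux_term]
        rw [Fintype.sum_eq_add a b hne]
        · have hs : Function.update Y b ⁅X, Y b⁆ =
              Function.update Y a ⁅X, Y a⁆ ∘ Equiv.swap a b := by
            funext i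
            by_cases hia : i = a
            · subst hia; simp [hne, hne.symm, hab]
            · by_cases hib : i = b
              · subst hib; simp [hab]
              · simp [Equiv.swap_apply_of_ne_of_ne hia hib, hia, hib]
          rw [hs]
          exact η.map_add_swap _ hne
        · rintro k ⟨hka, hkb⟩
          exact η.map_eq_zero_of_eq _ (by simp [Ne.symm hka, Ne.symm hkb, hab]) hne }
  map_add' X X' := by
    ext Y
    change (∑ k : Fin p, η.toMultilinearMap.compLinearMap _) Y =
      (∑ k : Fin p, η.toMultilinearMap.compLinearMap _) Y +
        (∑ k : Fin p, η.toMultilinearMap.compLinearMap _) Y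
    simp only [sum_apply, lieDerivAux_term, add_lie, AlternatingMap.map_update_add,
      Finset.sum_add_distrib]
  map_smul' c X := by
    ext Y
    change (∑ k : Fin p, η.toMultilinearMap.compLinearMap _) Y =
      c * (∑ k : Fin p, η.toMultilinearMap.compLinearMap _) Y
    simp only [sum_apply, lieDerivAux_term, smul_lie, AlternatingMap.map_update_smul,
      Finset.mul_sum, smul_eq_mul]

theorem lieDerivAux_apply {p : ℕ} (η : LieCochain L p) (X : L) (Y : Fin p → L) :
    lieDerivAux η X Y = ∑ k : Fin p, η (Function.update Y k ⁅X, Y k⁆) := by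
  change (∑ k : Fin p, η.toMultilinearMap.compLinearMap _) Y = _
  simp only [sum_apply, lieDerivAux_term]

theorem ceSum_eq_alternatize {p : ℕ} (η : LieCochain L p) (X : Fin (p + 1) → L) :
    ceSum η X = -(2⁻¹ : ℝ) * AlternatingMap.alternatizeUncurryFin (lieDerivAux η) X := by
  rw [AlternatingMap.alternatizeUncurryFin_apply]
  simp only [lieDerivAux_apply]
  let T : Fin (p + 1) → Fin (p + 1) → ℝ := fun i j =>
    (-1) ^ (j : ℕ) * η (j.removeNth (Function.update X i ⁅X i, X j⁆))
  have hsymm : ∀ i j, i ≠ j → T i j = T j i := by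
    intro i j hij
    have h := η.neg_one_pow_smul_map_removeNth_add_eq_zero_of_eq
      (v := Function.update (Function.update X i ⁅X i, X j⁆) j ⁅X i, X j⁆) (i := i) (j := j)
      (by simp [hij]) hij
    rw [Fin.removeNth_update, Function.update_comm hij, Fin.removeNth_update] at h
    obtain ⟨k, hk⟩ := Fin.exists_succAbove_eq hij.symm
    have hneg : η (i.removeNth (Function.update X j ⁅X j, X i⁆)) =
        - η (i.removeNth (Function.update X j ⁅X i, X j⁆)) := by
      rw [← lie_skew (X j) (X i), ← hk, Fin.removeNth_update_succAbove,
        Fin.removeNth_update_succAbove, AlternatingMap.map_update_neg]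
    simp only [T, hneg]
    simp only [zsmul_eq_mul, Int.cast_pow, Int.cast_neg, Int.cast_one] at h
    linarith
  have hsum : ∀ j : Fin (p + 1), (-1 : ℤ) ^ (j : ℕ) • ∑ k : Fin p,
      η (Function.update (j.removeNth X) k ⁅X j, j.removeNth X k⁆)
      = - ∑ i, if i = j then 0 else T i j := by
    intro j
    rw [Fin.sum_univ_succAbove _ j, if_pos rfl, zero_add, Finset.smul_sum,
      ← Finset.sum_neg_distrib]
    refine Finset.sum_congr rfl fun k _ => ?_
    rw [if_neg (Fin.succAbove_ne j k)]
    simp only [T]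
    rw [Fin.removeNth_update_succAbove, Fin.removeNth_apply, ← lie_skew (X j) _,
      AlternatingMap.map_update_neg]
    simp
  simp only [hsum, Finset.sum_neg_distrib]
  have hT : ∑ j, ∑ i, (if i = j then 0 else T i j) =
      (∑ j, ∑ i, if i < j then T i j else 0) + ∑ j, ∑ i, if i < j then T i j else 0 := by
    conv_rhs => arg 2; rw [Finset.sum_comm]
    simp only [← Finset.sum_add_distrib]
    refine Finset.sum_congr rfl fun j _ => Finset.sum_congr rfl fun i _ => ?_
    rcases lt_trichotomy i j with h | h | h
    · simp [h, h.ne, h.not_gt]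
    · simp [h]
    · simp [h, h.ne', h.not_gt, hsymm i j h.ne']
  rw [hT, ceSum_eq_ite]
  ring

/-- The Chevalley--Eilenberg differential `C^p(𝔤) → C^{p+1}(𝔤)`. -/
noncomputable def lieD (L : Type*) [LieRing L] [LieAlgebra ℝ L] (p : ℕ) :
    LieCochain L p →ₗ[ℝ] LieCochain L (p + 1) where
  toFun η :=
    { toFun := ceSum η
      map_update_add' := by
        intro _ X i x y
        obtain rfl : ‹DecidableEq (Fin (p + 1))› = instDecidableEqFin _ := Subsingleton.elim _ _
        simp only [ceSum_eq_alternatize, AlternatingMap.map_update_add, mul_add]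
      map_update_smul' := by
        intro _ X i c x
        obtain rfl : ‹DecidableEq (Fin (p + 1))› = instDecidableEqFin _ := Subsingleton.elim _ _
        simp only [ceSum_eq_alternatize, AlternatingMap.map_update_smul, smul_eq_mul]
        ring
      map_eq_zero_of_eq' := by
        intro X i j hX hij
        simp only [ceSum_eq_alternatize, AlternatingMap.map_eq_zero_of_eq _ X hX hij, mul_zero] }
  map_add' η θ := by
    ext X
    have h := congrFun (ceSum_add (η : (Fin p → L) → ℝ) θ 1) X
    rw [one_smul, one_smul] at h
    exact h
  map_smul' c η := by
    ext X
    have h := congrFun (ceSum_add (0 : (Fin p → L) → ℝ) η c) X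
    have h0 : ceSum (0 : (Fin p → L) → ℝ) X = 0 := by simp [ceSum]
    rw [zero_add, Pi.add_apply, h0, zero_add] at h
    exact h

theorem lieD_apply {p : ℕ} (η : LieCochain L p) (X : Fin (p + 1) → L) :
    lieD L p η X = ∑ i : Fin (p + 1), ∑ j ∈ Finset.Ioi i,
      (-1) ^ (j : ℕ) * η (j.removeNth (Function.update X i ⁅X i, X j⁆)) := rfl

theorem lieD_comp_lieD (p : ℕ) : lieD L (p + 1) ∘ₗ lieD L p = 0 := by
  ext η X
  exact congrFun (ceSum_ceSum (F := η) fun Y i x y => η.map_update_add Y i x y) X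

end LieAlgebraCochains

instance leInfty_minSmoothness_three : ENat.LEInfty (minSmoothness ℝ 3) := by
  rw [minSmoothness_of_isRCLikeNormedField]; infer_instance

instance completeSpace_of_finiteDimensional_real {E : Type*} [NormedAddCommGroup E]
    [NormedSpace ℝ E] [FiniteDimensional ℝ E] : CompleteSpace E := FiniteDimensional.complete ℝ E

/-! ### Smooth homogeneous group cochains -/

section GroupCochains

variable {E : Type*} [NormedAddCommGroup E] [NormedSpace ℝ E] {H : Type*} [TopologicalSpace H]
  (I : ModelWithCorners ℝ E H)

theorem contMDiff_reindex {G : Type*} [TopologicalSpace G] [ChartedSpace H G]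
    {ι κ : Type*} [Fintype ι] [Fintype κ] (σ : ι → κ) :
    ContMDiff (ModelWithCorners.pi fun _ : κ => I) (ModelWithCorners.pi fun _ : ι => I) ∞
      (fun g : κ → G => g ∘ σ) := by
  intro g
  rw [contMDiffAt_iff]
  refine ⟨(continuous_pi fun i => continuous_apply (σ i)).continuousAt, ?_⟩
  have h : ContDiff ℝ ∞ (fun v : κ → E => v ∘ σ) :=
    contDiff_pi.2 fun i => contDiff_apply ℝ E (σ i)
  have key : ∀ v ∈ (extChartAt (ModelWithCorners.pi fun _ : κ => I) g).target,
      (extChartAt (ModelWithCorners.pi fun _ : ι => I) (g ∘ σ) ∘ (fun g : κ → G => g ∘ σ) ∘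
        (extChartAt (ModelWithCorners.pi fun _ : κ => I) g).symm) v = v ∘ σ := by
    intro v hv
    funext i
    exact congrFun ((extChartAt (ModelWithCorners.pi fun _ : κ => I) g).right_inv hv) (σ i)
  refine h.contDiffWithinAt.congr_of_eventuallyEq (s := Set.range _) ?_
    (key _ (mem_extChartAt_target g))
  filter_upwards [extChartAt_target_mem_nhdsWithin (I := ModelWithCorners.pi fun _ : κ => I) g]
    with v hv using key v hv

variable (G : Type*) [TopologicalSpace G] [ChartedSpace H G] [Group G]

/-- The smooth homogeneous `p`-cochains of `G`: smooth functions `G^{p+1} → ℝ` that are invariant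
under the diagonal left action of `G`. -/
def groupCochain (p : ℕ) : Submodule ℝ ((Fin (p + 1) → G) → ℝ) where
  carrier := {F | ContMDiff (ModelWithCorners.pi fun _ : Fin (p + 1) => I) 𝓘(ℝ, ℝ) ∞ F ∧
    ∀ (h : G) (g : Fin (p + 1) → G), F (fun i => h * g i) = F g}
  add_mem' {F F'} hF hF' := ⟨hF.1.add hF'.1, fun h g => by
    simp only [Pi.add_apply, hF.2 h g, hF'.2 h g]⟩
  zero_mem' := ⟨contMDiff_const, fun _ _ => rfl⟩
  smul_mem' c F hF := ⟨by
    have h : ContMDiff (ModelWithCorners.pi fun _ : Fin (p + 1) => I) 𝓘(ℝ, ℝ) ∞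
        (fun g => c * F g) := contMDiff_const.mul hF.1
    exact h, fun h g => by
    simp only [Pi.smul_apply, hF.2 h g]⟩

/-- The coboundary `dF = F ∘ ∂`, that is
`dF(g_0, …, g_{p+1}) = ∑_i (-1)^i F(g_0, …, ĝ_i, …, g_{p+1})`. -/
def groupD (p : ℕ) : groupCochain I G p →ₗ[ℝ] groupCochain I G (p + 1) where
  toFun F := ⟨fun g => ∑ i : Fin (p + 2), (-1) ^ (i : ℕ) * F.1 (g ∘ i.succAbove), by
    refine ⟨?_, fun h g => ?_⟩
    · refine ContMDiff.sum fun i _ => ?_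
      exact contMDiff_const.mul (F.2.1.comp (contMDiff_reindex I i.succAbove))
    · exact Finset.sum_congr rfl fun i _ => congrArg _ (F.2.2 h (g ∘ i.succAbove))⟩
  map_add' F F' := by
    ext g
    simp [mul_add, Finset.sum_add_distrib]
  map_smul' c F := by
    ext g
    simp [Finset.mul_sum, mul_left_comm]

theorem groupD_apply {p : ℕ} (F : groupCochain I G p) (g : Fin (p + 2) → G) :
    (groupD I G p F).1 g = ∑ i : Fin (p + 2), (-1) ^ (i : ℕ) * F.1 (g ∘ i.succAbove) := rfl

theorem groupD_comp_groupD (p : ℕ) : groupD I G (p + 1) ∘ₗ groupD I G p = 0 := by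
  ext F g
  change ∑ i : Fin (p + 3), (-1) ^ (i : ℕ) * ∑ j : Fin (p + 2), (-1) ^ (j : ℕ) *
    F.1 (j.removeNth (i.removeNth g)) = 0
  simp only [Finset.mul_sum, Fin.sum_sum_eq_sum_triangle_add]
  refine Finset.sum_eq_zero fun i _ => Finset.sum_eq_zero fun j hj => ?_
  rw [Finset.mem_Ici] at hj
  rw [Fin.removeNth_removeNth_eq_swap (j := j.succ)]
  simp [Fin.predAbove, hj, Fin.succAbove, pow_succ]
  ring

end GroupCochains

/-! ### Simplices in a Lie group and integration over them -/

section Simplices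

variable {E : Type*} [NormedAddCommGroup E] [NormedSpace ℝ E] {H : Type*} [TopologicalSpace H]
  (I : ModelWithCorners ℝ E H) (G : Type*) [TopologicalSpace G] [ChartedSpace H G]

/-- A left-invariant notion of simplices in `G`: smooth maps `φ_p : Δ^p × G^{p+1} → G`, `p ≥ 0`.
Each `φ_p` is written as a function on `ℝ^{p+1} × G^{p+1}`; only its values on `Δ^p × G^{p+1}`
matter. The simplex `[g_0, …, g_p]` is `x ↦ φ p x g`. The `i`th face of `Δ^{p+1}` is the image of
`Δ^p` under the map that inserts a zero coordinate at position `i`. -/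
structure LeftInvariantSimplices [Group G] where
  /-- The maps `φ_p`. -/
  φ : ∀ p : ℕ, (Fin (p + 1) → ℝ) → (Fin (p + 1) → G) → G
  smooth : ∀ p : ℕ,
    ContMDiffOn (𝓘(ℝ, Fin (p + 1) → ℝ).prod (ModelWithCorners.pi fun _ : Fin (p + 1) => I)) I ∞
      (fun q : (Fin (p + 1) → ℝ) × (Fin (p + 1) → G) => φ p q.1 q.2)
      (stdSimplex ℝ (Fin (p + 1)) ×ˢ Set.univ)
  vertex : ∀ (p : ℕ) (g : Fin (p + 1) → G) (i : Fin (p + 1)), φ p (Pi.single i 1) g = g i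
  left_invariant : ∀ (p : ℕ) (h : G) (g : Fin (p + 1) → G), ∀ x ∈ stdSimplex ℝ (Fin (p + 1)),
    h * φ p x g = φ p x (fun i => h * g i)
  face : ∀ (p : ℕ) (g : Fin (p + 2) → G) (i : Fin (p + 2)), ∀ x ∈ stdSimplex ℝ (Fin (p + 1)),
    φ (p + 1) (i.insertNth (α := fun _ => ℝ) 0 x) g = φ p x (g ∘ i.succAbove)

variable {G}

/-- The left-invariant `p`-form on `G` that equals `η` on `𝔤 = T_1 G`:
at `g` it sends `v_1, …, v_p ∈ T_g G` to `η(g⁻¹ v_1, …, g⁻¹ v_p)`. -/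
noncomputable def leftInvariantForm [Group G] [FiniteDimensional ℝ E] [LieGroup I ∞ G] {p : ℕ}
    (η : LieCochain (GroupLieAlgebra I G) p) (g : G) : TangentSpace I g [⋀^Fin p]→ₗ[ℝ] ℝ :=
  η.compLinearMap (mfderiv I I (fun x : G => g⁻¹ * x) g).toLinearMap

/-- The simplex `{t ∈ ℝ^p : t_i ≥ 0, ∑ t_i ≤ 1}`, which parametrizes `Δ^p`. -/
def cornerSimplex (p : ℕ) : Set (Fin p → ℝ) := {t | (∀ i, 0 ≤ t i) ∧ ∑ i, t i ≤ 1}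

/-- The affine coordinates `(t_1, …, t_p) ↦ (1 - ∑ t_i, t_1, …, t_p)` on `Δ^p`. They give `Δ^p` the
standard orientation, the one of the frame `e_1 - e_0, …, e_p - e_0`. -/
def simplexCoord {p : ℕ} (t : Fin p → ℝ) : Fin (p + 1) → ℝ :=
  Fin.cons (α := fun _ => ℝ) (1 - ∑ i, t i) t

/-- The coefficient of the pullback `S^*θ` with respect to `dt_1 ∧ … ∧ dt_p`, for a `p`-form `θ`
and a `p`-simplex `S : Δ^p → G`. -/
noncomputable def pullbackCoeff {p : ℕ} (θ : ∀ g : G, TangentSpace I g [⋀^Fin p]→ₗ[ℝ] ℝ)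
    (S : (Fin (p + 1) → ℝ) → G) (t : Fin p → ℝ) : ℝ :=
  θ (S (simplexCoord t)) fun i =>
    mfderivWithin 𝓘(ℝ, Fin p → ℝ) I (fun s => S (simplexCoord s)) (cornerSimplex p) t
      (Pi.single i 1 : Fin p → ℝ)

/-- The integral `∫_S θ` of a `p`-form over a `p`-simplex. -/
noncomputable def simplexIntegral {p : ℕ} (θ : ∀ g : G, TangentSpace I g [⋀^Fin p]→ₗ[ℝ] ℝ)
    (S : (Fin (p + 1) → ℝ) → G) : ℝ :=
  ∫ t in cornerSimplex p, pullbackCoeff I θ S t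

end Simplices

/-! Left translation trivializes the tangent bundle of `G`, so everything can be computed with
functions on a simplex in `ℝ^p`. For a map `S` from the simplex to `G`, let `A` be the pullback of
the Maurer-Cartan form: `A_t(w)` is the derivative of `S(t)⁻¹ S(s)` in `s` at `s = t`, in direction
`w`. The pullback of the left-invariant form given by `η` then has coefficient `η(A e_0, …, A
e_{p-1})` (`pullbackCoeff_leftInvariantForm`). This function is smooth on a compact set, hence
integrable. It does not change when `S` is translated from the left, whence homogeneity. It is
smooth jointly in `t` and the vertices, so differentiation under the integral sign
(`contDiffOn_setIntegral`) gives a smooth cochain.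

The identity `∫ dη = d ∫ η` is Stokes' theorem, proved by hand. Put `f_j = η(A e_k : k ≠ j)`. By the
Leibniz rule and the structure equation `dA(v, w) = -[A v, A w]` (`maurerCartan_structure`), `∑_j
(-1)^j ∂_j f_j` equals `dη(A e_0, …, A e_p)` in the interior of the simplex. Fubini and the
fundamental theorem of calculus (`setIntegral_fderivWithin_cornerSimplex`) turn the integral of `∂_j
f_j` into the integral of `f_j` over the slanted face minus that over the face `t_j = 0`. The latter
is face `j + 1` of `Δ^{p+1}`. The slanted terms, summed over `j`, make up face `0`, because `η` is
alternating (`alternating_sub_zero_eq_sum`).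

The structure equation comes from the symmetry of a second derivative: in the chart `u` at `1` one
has `du = L(u) ∘ A`, where `L(x)` is the derivative of left translation by `x`, and the Lie bracket
is the antisymmetrized derivative of `L` at `1`. -/

open MeasureTheory Set Filter Topology

/-! ### Geometry of the corner simplex and calculus on it -/

section CornerSimplex

theorem isClosed_cornerSimplex (p : ℕ) : IsClosed (cornerSimplex p) := by
  have h : cornerSimplex p = (⋂ i, {t : Fin p → ℝ | 0 ≤ t i}) ∩ {t | ∑ i, t i ≤ 1} := by
    ext t; simp [cornerSimplex]
  rw [h]
  exact (isClosed_iInter fun i => isClosed_le continuous_const (continuous_apply i)).inter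
    (isClosed_le (by fun_prop) continuous_const)

theorem measurableSet_cornerSimplex (p : ℕ) : MeasurableSet (cornerSimplex p) :=
  (isClosed_cornerSimplex p).measurableSet

theorem isCompact_cornerSimplex (p : ℕ) : IsCompact (cornerSimplex p) := by
  refine (isCompact_Icc (a := (0 : Fin p → ℝ)) (b := 1)).of_isClosed_subset
    (isClosed_cornerSimplex p) fun t ht => ⟨ht.1, fun i => ?_⟩
  exact (Finset.single_le_sum (fun j _ => ht.1 j) (Finset.mem_univ i)).trans ht.2

theorem convex_cornerSimplex (p : ℕ) : Convex ℝ (cornerSimplex p) := by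
  intro x hx y hy a b ha hb hab
  refine ⟨fun i => ?_, ?_⟩
  · simpa using add_nonneg (mul_nonneg ha (hx.1 i)) (mul_nonneg hb (hy.1 i))
  · simp only [Pi.add_apply, Pi.smul_apply, smul_eq_mul, Finset.sum_add_distrib, ← Finset.mul_sum]
    nlinarith [mul_le_mul_of_nonneg_left hx.2 ha, mul_le_mul_of_nonneg_left hy.2 hb]

theorem interior_cornerSimplex_nonempty (p : ℕ) : (interior (cornerSimplex p)).Nonempty := by
  have ho : IsOpen ((⋂ i, {t : Fin p → ℝ | 0 < t i}) ∩ {t | ∑ i, t i < 1}) :=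
    (isOpen_iInter_of_finite fun i => isOpen_lt continuous_const (continuous_apply i)).inter
      (isOpen_lt (by fun_prop) continuous_const)
  -- The `p` equal coordinates add up to `p / (p + 1) < 1`.
  refine ⟨fun _ => 1 / (p + 1), interior_maximal ?_ ho ⟨?_, ?_⟩⟩
  · rintro t ⟨h1, h2⟩
    exact ⟨fun i => (mem_iInter.1 h1 i).le, le_of_lt h2⟩
  · exact mem_iInter.2 fun i => by simp only [mem_ofPred_eq]; positivity
  · simp only [mem_ofPred_eq, Finset.sum_const, Finset.card_univ, Fintype.card_fin, nsmul_eq_mul]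
    rw [mul_one_div, div_lt_one (by positivity)]
    linarith

theorem uniqueDiffOn_cornerSimplex (p : ℕ) : UniqueDiffOn ℝ (cornerSimplex p) :=
  uniqueDiffOn_convex (convex_cornerSimplex p) (interior_cornerSimplex_nonempty p)

theorem simplexCoord_mem_stdSimplex {p : ℕ} {t : Fin p → ℝ} (ht : t ∈ cornerSimplex p) :
    simplexCoord t ∈ stdSimplex ℝ (Fin (p + 1)) := by
  refine ⟨fun i => ?_, ?_⟩
  · refine Fin.cases ?_ (fun j => ?_) i
    · simpa [simplexCoord] using ht.2
    · simpa [simplexCoord] using ht.1 j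
  · simp [simplexCoord, Fin.sum_univ_succ]

theorem sum_simplexCoord {p : ℕ} (t : Fin p → ℝ) : ∑ i, simplexCoord t i = 1 := by
  simp [simplexCoord, Fin.sum_univ_succ]

/-- Besides giving barycentric coordinates, `simplexCoord` parametrizes the slanted face `∑ t_i = 1`
of the corner simplex one dimension higher. -/
theorem simplexCoord_mem_cornerSimplex {p : ℕ} {t : Fin p → ℝ} (ht : t ∈ cornerSimplex p) :
    simplexCoord t ∈ cornerSimplex (p + 1) :=
  ⟨(simplexCoord_mem_stdSimplex ht).1, (sum_simplexCoord t).le⟩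

theorem contDiff_simplexCoord (p : ℕ) {n : WithTop ℕ∞} :
    ContDiff ℝ n (simplexCoord : (Fin p → ℝ) → Fin (p + 1) → ℝ) := by
  refine contDiff_pi.2 fun i => Fin.cases ?_ (fun j => ?_) i
  · simp only [simplexCoord, Fin.cons_zero]; fun_prop
  · simp only [simplexCoord, Fin.cons_succ]; fun_prop

/-- Describes the slices for Fubini: a line in direction `i` meets the simplex in a segment running
from the face `t_i = 0` to the slanted face. -/
theorem insertNth_mem_cornerSimplex_iff {p : ℕ} (i : Fin (p + 1)) (s : ℝ) (y : Fin p → ℝ) :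
    i.insertNth (α := fun _ => ℝ) s y ∈ cornerSimplex (p + 1) ↔
      y ∈ cornerSimplex p ∧ s ∈ Icc 0 (1 - ∑ j, y j) := by
  simp only [cornerSimplex, mem_ofPred_eq, Fin.forall_iff_succAbove i, Fin.sum_univ_succAbove _ i,
    Fin.insertNth_apply_same, Fin.insertNth_apply_succAbove, mem_Icc]
  constructor
  · rintro ⟨⟨h1, h2⟩, h3⟩; exact ⟨⟨h2, by linarith⟩, h1, by linarith⟩
  · rintro ⟨⟨h1, h2⟩, h3, h4⟩; exact ⟨⟨h3, h1⟩, by linarith⟩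

theorem contDiff_insertNth {p : ℕ} (i : Fin (p + 1)) (c : ℝ) {n : WithTop ℕ∞} :
    ContDiff ℝ n (fun y : Fin p → ℝ => i.insertNth (α := fun _ => ℝ) c y) := by
  refine contDiff_pi.2 fun j => ?_
  rcases Fin.eq_self_or_eq_succAbove i j with rfl | ⟨k, rfl⟩
  · simp only [Fin.insertNth_apply_same]; fun_prop
  · simp only [Fin.insertNth_apply_succAbove]; fun_prop

/-- The parametrizations of the slanted face of the corner simplex by all but the `i`th
coordinate and by all but the `0`th differ by a volume-preserving map. -/
theorem measurePreserving_removeNth_simplexCoord {p : ℕ} (i : Fin (p + 1)) :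
    MeasurePreserving (fun y : Fin p → ℝ => i.removeNth (simplexCoord y)) := by
  refine Fin.cases ?_ (fun j => ?_) i
  · have h : (fun y : Fin p → ℝ => Fin.removeNth 0 (simplexCoord y)) = id := by
      funext y k; simp [simplexCoord, Fin.removeNth]
    rw [h]; exact MeasurePreserving.id _
  · obtain _ | q := p
    · exact j.elim0
    -- Split off the coordinate `s = y_j` and call the rest `r`. The map fixes `r`, sends `s` to `(1
    -- - ∑ r) - s`, a reflection for each `r`, and moves the result to slot `0`.
    have h1 := volume_preserving_piFinSuccAbove (fun _ : Fin (q + 1) => ℝ) j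
    have h2 := (volume_preserving_piFinSuccAbove (fun _ : Fin (q + 1) => ℝ) 0).symm
    have h3 : MeasurePreserving
        (fun z : (Fin q → ℝ) × ℝ => (z.1, (1 - ∑ k, z.1 k) - z.2)) :=
      (MeasurePreserving.id _).skew_product
        (g := fun (r : Fin q → ℝ) (s : ℝ) => (1 - ∑ k, r k) - s)
        (by unfold Function.uncurry; fun_prop)
        (ae_of_all _ fun r => (Measure.measurePreserving_sub_left volume (1 - ∑ k, r k)).map_eq)
    have h4 := h2.comp (Measure.measurePreserving_swap.comp
      (h3.comp (Measure.measurePreserving_swap.comp h1)))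
    convert h4 using 1
    funext y k
    refine Fin.cases ?_ (fun l => ?_) k
    · simp [Fin.removeNth, simplexCoord, Fin.sum_univ_succAbove _ j, Fin.insertNthEquiv]
      ring
    · simp [Fin.removeNth, simplexCoord, Fin.insertNthEquiv]

/-- Integration in direction `i` describes the slanted face as a graph over the other coordinates.
Passing to the common parametrization `simplexCoord` preserves volume, so the terms of different `i`
can later be added. -/
theorem setIntegral_slanted_face {p : ℕ} (i : Fin (p + 1)) (f : (Fin (p + 1) → ℝ) → ℝ) :
    ∫ y in cornerSimplex p, f (i.insertNth (α := fun _ => ℝ) (1 - ∑ j, y j) y) =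
      ∫ y in cornerSimplex p, f (simplexCoord y) := by
  have hrec : ∀ y : Fin p → ℝ, i.insertNth (α := fun _ => ℝ)
      (1 - ∑ j, i.removeNth (simplexCoord y) j) (i.removeNth (simplexCoord y)) =
        simplexCoord y := by
    intro y
    have h := sum_simplexCoord y
    rw [Fin.sum_univ_succAbove _ i] at h
    have h' : 1 - ∑ j, i.removeNth (simplexCoord y) j = simplexCoord y i := by
      simp only [Fin.removeNth]; linarith
    rw [h', Fin.insertNth_self_removeNth]
  have hinj : Function.Injective (fun y : Fin p → ℝ => i.removeNth (simplexCoord y)) := by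
    intro y z hyz
    have : simplexCoord y = simplexCoord z := by
      rw [← hrec y, ← hrec z]; simp only at hyz; rw [hyz]
    exact Fin.cons_right_injective (α := fun _ => ℝ) _ (by
      have h0 := congrFun this 0
      simp only [simplexCoord] at this h0
      simp only [Fin.cons_zero] at h0
      rw [h0] at this
      exact this)
  have hcont : Continuous (fun y : Fin p → ℝ => i.removeNth (simplexCoord y)) :=
    continuous_pi fun j => (continuous_apply _).comp (contDiff_simplexCoord p (n := 0)).continuous
  have hpre : (fun y : Fin p → ℝ => i.removeNth (simplexCoord y)) ⁻¹' cornerSimplex p =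
      cornerSimplex p := by
    ext y
    have h0 : simplexCoord y ∈ cornerSimplex (p + 1) ↔ y ∈ cornerSimplex p := by
      have : simplexCoord y = (0 : Fin (p + 1)).insertNth (α := fun _ => ℝ) (1 - ∑ j, y j) y := by
        rw [Fin.insertNth_zero']; rfl
      rw [this, insertNth_mem_cornerSimplex_iff]
      exact ⟨fun h => h.1, fun h => ⟨h, by simpa using h.2, le_rfl⟩⟩
    rw [← h0, ← hrec y, insertNth_mem_cornerSimplex_iff, mem_preimage]
    exact ⟨fun h => ⟨h, by simpa using h.2, le_rfl⟩, fun h => h.1⟩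
  have := (measurePreserving_removeNth_simplexCoord i).setIntegral_preimage_emb
    (hcont.measurableEmbedding hinj)
    (fun y => f (i.insertNth (α := fun _ => ℝ) (1 - ∑ j, y j) y)) (cornerSimplex p)
  rw [← this, hpre]
  simp only [hrec]

theorem hasDerivAt_insertNth {p : ℕ} (i : Fin (p + 1)) (y : Fin p → ℝ) (s : ℝ) :
    HasDerivAt (fun s : ℝ => i.insertNth (α := fun _ => ℝ) s y) (Pi.single i 1) s := by
  refine hasDerivAt_pi.2 fun j => ?_
  rcases Fin.eq_self_or_eq_succAbove i j with rfl | ⟨k, rfl⟩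
  · simpa using hasDerivAt_id' s
  · simpa using hasDerivAt_const s (y k)

theorem continuousOn_fderivWithin_cornerSimplex {p : ℕ} {f : (Fin p → ℝ) → ℝ}
    (hf : ContDiffOn ℝ 1 f (cornerSimplex p)) (v : Fin p → ℝ) :
    ContinuousOn (fun t => fderivWithin ℝ f (cornerSimplex p) t v) (cornerSimplex p) :=
  (hf.continuousOn_fderivWithin (uniqueDiffOn_cornerSimplex p) le_rfl).clm_apply
    continuousOn_const

/-- Fubini and the fundamental theorem of calculus in the `i`th direction. -/
theorem setIntegral_fderivWithin_cornerSimplex {p : ℕ} {f : (Fin (p + 1) → ℝ) → ℝ}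
    (hf : ContDiffOn ℝ 1 f (cornerSimplex (p + 1))) (i : Fin (p + 1)) :
    ∫ t in cornerSimplex (p + 1), fderivWithin ℝ f (cornerSimplex (p + 1)) t (Pi.single i 1) =
      (∫ t in cornerSimplex p, f (simplexCoord t)) -
        ∫ t in cornerSimplex p, f (i.insertNth (α := fun _ => ℝ) 0 t) := by
  set K := cornerSimplex (p + 1) with hK
  set h := fun t => fderivWithin ℝ f K t (Pi.single i 1) with hh
  have hcont : ContinuousOn h K := continuousOn_fderivWithin_cornerSimplex hf _
  have h_int : Integrable (K.indicator h) :=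
    (integrable_indicator_iff (measurableSet_cornerSimplex _)).2
      (hcont.integrableOn_compact (isCompact_cornerSimplex _))
  have hmp := (volume_preserving_piFinSuccAbove (fun _ : Fin (p + 1) => ℝ) i).symm
  have hins : ∀ z : ℝ × (Fin p → ℝ), (MeasurableEquiv.piFinSuccAbove (fun _ => ℝ) i).symm z =
      i.insertNth (α := fun _ => ℝ) z.1 z.2 := fun z => rfl
  -- The slice over `y` is a segment, or empty when `y` lies outside the smaller simplex.
  have inner : ∀ y : Fin p → ℝ, ∫ s, K.indicator h (i.insertNth (α := fun _ => ℝ) s y) =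
      (cornerSimplex p).indicator (fun y => f (i.insertNth (α := fun _ => ℝ) (1 - ∑ j, y j) y)
        - f (i.insertNth (α := fun _ => ℝ) 0 y)) y := by
    intro y
    by_cases hy : y ∈ cornerSimplex p
    · have hle : 0 ≤ 1 - ∑ j, y j := by simpa using hy.2
      have h1 : (fun s => K.indicator h (i.insertNth (α := fun _ => ℝ) s y)) =
          (Icc 0 (1 - ∑ j, y j)).indicator (fun s => h (i.insertNth (α := fun _ => ℝ) s y)) := by
        funext s
        by_cases hs : s ∈ Icc 0 (1 - ∑ j, y j)
        · rw [indicator_of_mem hs,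
            indicator_of_mem ((insertNth_mem_cornerSimplex_iff i s y).2 ⟨hy, hs⟩)]
        · rw [indicator_of_notMem hs, indicator_of_notMem fun hc =>
            hs ((insertNth_mem_cornerSimplex_iff i s y).1 hc).2]
      have hmaps : MapsTo (fun s => i.insertNth (α := fun _ => ℝ) s y)
          (Icc 0 (1 - ∑ j, y j)) K := fun s hs =>
        (insertNth_mem_cornerSimplex_iff i s y).2 ⟨hy, hs⟩
      have hci : Continuous (fun s : ℝ => i.insertNth (α := fun _ => ℝ) s y) :=
        continuous_iff_continuousAt.2 fun s => (hasDerivAt_insertNth i y s).continuousAt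
      rw [h1, integral_indicator measurableSet_Icc, integral_Icc_eq_integral_Ioc,
        ← intervalIntegral.integral_of_le hle, indicator_of_mem hy]
      -- Two-sided derivatives are needed only inside the segment. The derivative within `K`
      -- supplies them even if the whole segment lies in the boundary of `K`, since the segment
      -- stays in `K`.
      refine intervalIntegral.integral_eq_sub_of_hasDerivAt_of_le
        (f := fun s => f (i.insertNth (α := fun _ => ℝ) s y)) hle
        (hf.continuousOn.comp hci.continuousOn hmaps) (fun s hs => ?_) ?_
      · have hmem := hmaps (Ioo_subset_Icc_self hs)
        have hd := ((hf.differentiableOn one_ne_zero) _ hmem).hasFDerivWithinAt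
        exact (hd.comp_hasDerivWithinAt s (hasDerivAt_insertNth i y s).hasDerivWithinAt
          hmaps).hasDerivAt (Icc_mem_nhds hs.1 hs.2)
      · refine ContinuousOn.intervalIntegrable ?_
        rw [uIcc_of_le hle]
        exact hcont.comp hci.continuousOn hmaps
    · have h1 : (fun s => K.indicator h (i.insertNth (α := fun _ => ℝ) s y)) = fun _ => 0 := by
        funext s
        exact indicator_of_notMem (fun hc => hy ((insertNth_mem_cornerSimplex_iff i s y).1 hc).1) _
      rw [h1, integral_zero, indicator_of_notMem hy]
  have h_int2 : Integrable (fun z : ℝ × (Fin p → ℝ) =>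
      K.indicator h (i.insertNth (α := fun _ => ℝ) z.1 z.2)) (volume.prod volume) := by
    have := hmp.integrable_comp_emb (MeasurableEquiv.measurableEmbedding _) (g := K.indicator h)
    exact this.2 h_int
  rw [← integral_indicator (measurableSet_cornerSimplex _), ← hmp.integral_comp', Measure.volume_eq_prod]
  simp only [hins]
  rw [integral_prod_symm _ h_int2]
  simp only [inner]
  rw [integral_indicator (measurableSet_cornerSimplex _), integral_sub,
    setIntegral_slanted_face i f]
  · refine ContinuousOn.integrableOn_compact (isCompact_cornerSimplex _)
      (hf.continuousOn.comp (Continuous.continuousOn ?_) fun y hy =>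
        (insertNth_mem_cornerSimplex_iff i _ y).2 ⟨hy, by simpa using hy.2, le_rfl⟩)
    refine continuous_pi fun j => ?_
    rcases Fin.eq_self_or_eq_succAbove i j with rfl | ⟨k, rfl⟩
    · simp only [Fin.insertNth_apply_same]; fun_prop
    · simp only [Fin.insertNth_apply_succAbove]; fun_prop
  · refine ContinuousOn.integrableOn_compact (isCompact_cornerSimplex _)
      (hf.continuousOn.comp (contDiff_insertNth i 0 (n := 0)).continuous.continuousOn fun y hy =>
        (insertNth_mem_cornerSimplex_iff i _ y).2 ⟨hy, le_rfl, by simpa using hy.2⟩)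

end CornerSimplex

/-! ### Differentiation under the integral sign -/

section ParametricIntegral

variable {D P : Type*} [NormedAddCommGroup D] [NormedSpace ℝ D] [MeasurableSpace D]
  [BorelSpace D] [NormedAddCommGroup P] [NormedSpace ℝ P] [FiniteDimensional ℝ P]
  {μ : Measure D} [IsFiniteMeasureOnCompacts μ] {K : Set D} {U : Set P} {f : D × P → ℝ}

/-- The partial derivative in the parameter is continuous on `K` times a closed ball. That product
is compact because `P` is finite-dimensional, so a constant dominates. -/
theorem hasFDerivAt_setIntegral_of_contDiffOn (hK : IsCompact K) (hKu : UniqueDiffOn ℝ K)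
    (hU : IsOpen U) (hf : ContDiffOn ℝ 1 f (K ×ˢ U)) {v₀ : P} (hv₀ : v₀ ∈ U) :
    HasFDerivAt (fun v => ∫ t in K, f (t, v) ∂μ)
      (∫ t in K, (fderivWithin ℝ f (K ×ˢ U) (t, v₀)).comp (ContinuousLinearMap.inr ℝ D P) ∂μ)
      v₀ := by
  have hKU : UniqueDiffOn ℝ (K ×ˢ U) := hKu.prod hU.uniqueDiffOn
  set F' : P → D → P →L[ℝ] ℝ := fun v t =>
    (fderivWithin ℝ f (K ×ˢ U) (t, v)).comp (ContinuousLinearMap.inr ℝ D P) with hF'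
  have hcont' : ContinuousOn (fun z : D × P => F' z.2 z.1) (K ×ˢ U) :=
    (hf.continuousOn_fderivWithin hKU le_rfl).clm_comp continuousOn_const
  obtain ⟨ε, hε, hball⟩ := Metric.nhds_basis_closedBall.mem_iff.1 (hU.mem_nhds hv₀)
  obtain ⟨C, hC⟩ := (hK.prod (isCompact_closedBall v₀ ε)).exists_bound_of_continuousOn
    (hcont'.mono (prod_mono_right hball))
  have hslice : ∀ v ∈ U, ContinuousOn (fun t => (t, v)) K ∧ MapsTo (fun t => (t, v)) K (K ×ˢ U) :=
    fun v hv => ⟨by fun_prop, fun t ht => ⟨ht, hv⟩⟩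
  have h_int : ∀ v ∈ U, IntegrableOn (fun t => f (t, v)) K μ := fun v hv =>
    (hf.continuousOn.comp (hslice v hv).1 (hslice v hv).2).integrableOn_compact hK
  refine hasFDerivAt_integral_of_dominated_of_fderiv_le (F' := F') (bound := fun _ => C)
    (Metric.closedBall_mem_nhds v₀ hε) ?_ (h_int v₀ hv₀) ?_ ?_ ?_ ?_
  · filter_upwards [hU.mem_nhds hv₀] with v hv using (h_int v hv).aestronglyMeasurable
  · exact ((hcont'.comp (hslice v₀ hv₀).1 (hslice v₀ hv₀).2).integrableOn_compact
      (μ := μ) hK).aestronglyMeasurable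
  · filter_upwards [ae_restrict_mem hK.measurableSet] with t ht v hv using hC (t, v) ⟨ht, hv⟩
  · exact integrableOn_const hK.measure_ne_top
  · filter_upwards [ae_restrict_mem hK.measurableSet] with t ht v hv
    have h1 := (hf.differentiableOn one_ne_zero (t, v) ⟨ht, hball hv⟩).hasFDerivWithinAt
    have h2 : HasFDerivWithinAt (fun v : P => (t, v)) (ContinuousLinearMap.inr ℝ D P) U v :=
      (hasFDerivAt_prodMk_right t v).hasFDerivWithinAt
    exact (h1.comp v h2 fun w hw => ⟨ht, hw⟩).hasFDerivAt (hU.mem_nhds (hball hv))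

/-- The integral over a compact set of a function that is smooth in the variable and a parameter
is smooth in the parameter. -/
theorem contDiffOn_setIntegral (hK : IsCompact K) (hKu : UniqueDiffOn ℝ K) (hU : IsOpen U)
    (hf : ContDiffOn ℝ ∞ f (K ×ˢ U)) : ContDiffOn ℝ ∞ (fun v => ∫ t in K, f (t, v) ∂μ) U := by
  have hKU : UniqueDiffOn ℝ (K ×ˢ U) := hKu.prod hU.uniqueDiffOn
  refine contDiffOn_infty.2 fun n => ?_
  -- A directional derivative of the integral is the integral of another smooth function on `K ×ˢ
  -- U`, so the induction has to range over all `f`.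
  induction n generalizing f with
  | zero =>
    exact contDiffOn_zero.2 fun v hv => (hasFDerivAt_setIntegral_of_contDiffOn hK hKu hU
      (hf.of_le (by simp)) hv).continuousAt.continuousWithinAt
  | succ n ih =>
    have hd := fun v (hv : v ∈ U) => hasFDerivAt_setIntegral_of_contDiffOn (μ := μ) hK hKu hU
      (hf.of_le (by simp)) hv
    push_cast
    rw [contDiffOn_succ_iff_fderiv_apply hU.uniqueDiffOn]
    refine ⟨fun v hv => (hd v hv).differentiableAt.differentiableWithinAt, by simp, fun w => ?_⟩
    have hg : ContDiffOn ℝ ∞ (fun z => fderivWithin ℝ f (K ×ˢ U) z (0, w)) (K ×ˢ U) :=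
      (hf.fderivWithin hKU (by simp)).clm_apply contDiffOn_const
    refine (ih hg).congr fun v hv => ?_
    rw [fderivWithin_of_isOpen hU hv, (hd v hv).fderiv, ContinuousLinearMap.integral_apply]
    · simp
    · refine ContinuousOn.integrableOn_compact hK ?_
      exact ((hf.continuousOn_fderivWithin hKU (by simp)).comp (by fun_prop)
        (fun t ht => ⟨ht, hv⟩)).clm_comp continuousOn_const

end ParametricIntegral

/-! ### Identities for alternating forms -/

section Alternating

/-- An alternating map is unchanged when one argument is subtracted from the others. -/
theorem AlternatingMap.map_sub_arg {R M N ι : Type*} [CommRing R] [AddCommGroup M] [Module R M]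
    [AddCommGroup N] [Module R N] [DecidableEq ι] (f : M [⋀^ι]→ₗ[R] N) (v : ι → M) (i : ι)
    (s : Finset ι) (hs : i ∉ s) : f (fun k => if k ∈ s then v k - v i else v k) = f v := by
  induction s using Finset.induction_on with
  | empty => simp
  | insert a s ha ih =>
    have hia : i ≠ a := fun h => hs (by simp [h])
    have his : i ∉ s := fun h => hs (by simp [h])
    have h1 : (fun k => if k ∈ insert a s then v k - v i else v k) =
        Function.update (fun k => if k ∈ s then v k - v i else v k) a (v a - v i) := by
      funext k
      by_cases hk : k = a
      · subst hk; simp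
      · simp [hk]
    have h2 : Function.update (fun k => if k ∈ s then v k - v i else v k) a (v a) =
        fun k => if k ∈ s then v k - v i else v k := by
      funext k
      by_cases hk : k = a
      · subst hk; simp [ha]
      · simp [hk]
    rw [h1, f.map_update_sub, h2, ih his, sub_eq_self]
    exact f.map_eq_zero_of_eq _ (by simp [hia, his]) hia

variable {V : Type*} [AddCommGroup V] [Module ℝ V]

/-- The vectors `e_{k+1} - e_0` span the slanted face, so this identity assembles the slanted
boundary terms into the integral over face `0`. -/
theorem alternating_sub_zero_eq_sum {p : ℕ} (η : V [⋀^Fin p]→ₗ[ℝ] ℝ) (a : Fin (p + 1) → V) :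
    η (fun k => a k.succ - a 0) = ∑ j : Fin (p + 1), (-1) ^ (j : ℕ) * η (a ∘ j.succAbove) := by
  -- The wedge of the last coordinate of `V × ℝ` with `η` is evaluated on the vectors `(a_k, 1)`.
  -- Subtracting the `0`th from the others makes their last coordinates vanish and leaves a single
  -- term.
  let θ : (V × ℝ) →ₗ[ℝ] (V × ℝ) [⋀^Fin p]→ₗ[ℝ] ℝ :=
    (LinearMap.snd ℝ V ℝ).smulRight (η.compLinearMap (LinearMap.fst ℝ V ℝ))
  have hθ : ∀ X : Fin (p + 1) → V × ℝ, AlternatingMap.alternatizeUncurryFin θ X =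
      ∑ j : Fin (p + 1), (-1) ^ (j : ℕ) * ((X j).2 * η (fun k => (X (j.succAbove k)).1)) := by
    intro X
    rw [AlternatingMap.alternatizeUncurryFin_apply]
    refine Finset.sum_congr rfl fun j _ => ?_
    simp only [zsmul_eq_mul, Int.cast_pow, Int.cast_neg, Int.cast_one]
    rfl
  have h := (AlternatingMap.alternatizeUncurryFin θ).map_sub_arg (fun k => (a k, (1 : ℝ))) 0
    (Finset.univ.erase 0) (by simp)
  rw [hθ, hθ, Fin.sum_univ_succ] at h
  simpa [Function.comp_def] using h

/-- The antisymmetrization of a first derivative of the components of an alternating form. -/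
theorem sum_alternating_update_removeNth {p : ℕ} (η : V [⋀^Fin p]→ₗ[ℝ] ℝ) (a : Fin (p + 1) → V)
    (B : Fin (p + 1) → Fin (p + 1) → V) :
    ∑ i : Fin (p + 1), (-1) ^ (i : ℕ) *
        ∑ k : Fin p, η (Function.update (i.removeNth a) k (B i (i.succAbove k))) =
      ∑ i : Fin (p + 1), ∑ j ∈ Finset.Ioi i, (-1) ^ (j : ℕ) *
        η (j.removeNth (Function.update a i (B j i - B i j))) := by
  let T : Fin (p + 1) → Fin (p + 1) → V → ℝ := fun i j x =>
    (-1) ^ (j : ℕ) * η (j.removeNth (Function.update a i x))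
  -- With `x` in both slots `i` and `j`, deleting either slot leaves the same vectors up to a
  -- permutation, of sign `-(-1)^(i+j)`.
  have hsymm : ∀ i j x, i ≠ j → T i j x = - T j i x := by
    intro i j x hij
    have h := η.neg_one_pow_smul_map_removeNth_add_eq_zero_of_eq
      (v := Function.update (Function.update a i x) j x) (i := i) (j := j)
      (by simp [hij]) hij
    rw [Fin.removeNth_update, Function.update_comm hij, Fin.removeNth_update] at h
    simp only [zsmul_eq_mul, Int.cast_pow, Int.cast_neg, Int.cast_one] at h
    simp only [T]
    linarith
  have hsum : ∀ i : Fin (p + 1), (-1) ^ (i : ℕ) *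
      ∑ k : Fin p, η (Function.update (i.removeNth a) k (B i (i.succAbove k))) =
        ∑ j, if j = i then 0 else T j i (B i j) := by
    intro i
    rw [Fin.sum_univ_succAbove _ i, if_pos rfl, zero_add, Finset.mul_sum]
    refine Finset.sum_congr rfl fun k _ => ?_
    rw [if_neg (Fin.succAbove_ne i k)]
    simp only [T]
    rw [Fin.removeNth_update_succAbove]
  -- Each unordered pair of indices occurs twice. Both occurrences are written with `i < j`, and
  -- `hsymm` then merges them into the difference `B j i - B i j`.
  have hT : ∑ i, ∑ j, (if j = i then 0 else T j i (B i j)) =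
      (∑ i, ∑ j, if i < j then T i j (B j i) else 0) +
        ∑ i, ∑ j, if i < j then T j i (B i j) else 0 := by
    conv_rhs => arg 1; rw [Finset.sum_comm]
    simp only [← Finset.sum_add_distrib]
    refine Finset.sum_congr rfl fun j _ => Finset.sum_congr rfl fun i _ => ?_
    rcases lt_trichotomy i j with h | h | h
    · simp [h, h.ne, h.not_gt]
    · simp [h]
    · simp [h, h.ne', h.not_gt]
  simp only [hsum]
  rw [hT]
  simp only [← Finset.sum_add_distrib]
  refine Finset.sum_congr rfl fun i _ => ?_
  have hIoi : Finset.Ioi i = Finset.univ.filter (i < ·) := by ext; simp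
  rw [hIoi, Finset.sum_filter]
  refine Finset.sum_congr rfl fun j _ => ?_
  by_cases hij : i < j
  · simp only [hij, if_true]
    rw [hsymm j i _ hij.ne', ← sub_eq_add_neg]
    simp only [T]
    obtain ⟨k, hk⟩ := Fin.exists_succAbove_eq hij.ne
    rw [← mul_sub, ← hk, Fin.removeNth_update_succAbove, Fin.removeNth_update_succAbove,
      Fin.removeNth_update_succAbove, η.map_update_sub]
  · simp [hij]

end Alternating

/-! ### Smoothness of multilinear forms and the Leibniz rule -/

section MultilinearFiniteDimensional

variable {E : Type*} [NormedAddCommGroup E] [NormedSpace ℝ E] [FiniteDimensional ℝ E]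

theorem MultilinearMap.continuous_of_finiteDimensional_real {p : ℕ}
    (f : MultilinearMap ℝ (fun _ : Fin p => E) ℝ) : Continuous f := by
  let b := Module.finBasis ℝ E
  have h : (f : (Fin p → E) → ℝ) = fun v => ∑ σ : Fin p → Fin (Module.finrank ℝ E),
      (∏ i, b.repr (v i) (σ i)) * f (fun i => b (σ i)) := by
    funext v
    conv_lhs => rw [show v = fun i => ∑ j, b.repr (v i) j • b j from
      funext fun i => (b.sum_repr (v i)).symm]
    rw [f.map_sum]
    refine Finset.sum_congr rfl fun σ _ => ?_
    rw [f.map_smul_univ, smul_eq_mul]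
  rw [h]
  refine continuous_finsetSum _ fun σ _ => (continuous_finsetProd _ fun i _ => ?_).mul
    continuous_const
  exact (LinearMap.continuous_of_finiteDimensional (b.coord (σ i))).comp (continuous_apply i)

/-- An alternating form on a finite-dimensional space as a continuous alternating form. -/
def AlternatingMap.toContinuousMultilinear {p : ℕ} (η : E [⋀^Fin p]→ₗ[ℝ] ℝ) :
    ContinuousMultilinearMap ℝ (fun _ : Fin p => E) ℝ :=
  { η.toMultilinearMap with cont := η.toMultilinearMap.continuous_of_finiteDimensional_real }

theorem AlternatingMap.contDiff {p : ℕ} (η : E [⋀^Fin p]→ₗ[ℝ] ℝ) {n : WithTop ℕ∞} :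
    ContDiff ℝ n (η : (Fin p → E) → ℝ) :=
  η.toContinuousMultilinear.contDiff

theorem AlternatingMap.fderiv_comp {D : Type*} [NormedAddCommGroup D] [NormedSpace ℝ D]
    {p : ℕ} (η : E [⋀^Fin p]→ₗ[ℝ] ℝ) {a : Fin p → D → E} {t : D}
    (ha : ∀ k, DifferentiableAt ℝ (a k) t) (w : D) :
    fderiv ℝ (fun s => η (fun k => a k s)) t w =
      ∑ k, η (Function.update (fun l => a l t) k (fderiv ℝ (a k) t w)) := by
  have h1 := (η.toContinuousMultilinear).hasFDerivAt (fun l => a l t)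
  have h2 : HasFDerivAt (fun s k => a k s) (ContinuousLinearMap.pi fun k => fderiv ℝ (a k) t) t :=
    hasFDerivAt_pi.2 fun k => (ha k).hasFDerivAt
  have h3 := h1.comp t h2
  have h4 : (fun s => η (fun k => a k s)) =
      (η.toContinuousMultilinear : (Fin p → E) → ℝ) ∘ fun s k => a k s := rfl
  rw [h4, h3.fderiv]
  simp only [ContinuousLinearMap.comp_apply, ContinuousMultilinearMap.linearDeriv_apply]
  rfl

end MultilinearFiniteDimensional

/-! ### Finite powers of a manifold -/

section PiManifold

variable {E : Type*} [NormedAddCommGroup E] [NormedSpace ℝ E] {H : Type*} [TopologicalSpace H]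
  (I : ModelWithCorners ℝ E H)

/-- Transition maps between product charts act coordinatewise by transition maps of `G`. -/
theorem isManifold_pi {ι : Type*} [Fintype ι] (n : WithTop ℕ∞) (G : Type*) [TopologicalSpace G]
    [ChartedSpace H G] [IsManifold I n G] :
    IsManifold (ModelWithCorners.pi fun _ : ι => I) n (ι → G) := by
  refine isManifold_of_contDiffOn _ n _ ?_
  rintro _ _ ⟨e, he, rfl⟩ ⟨e', he', rfl⟩
  refine contDiffOn_pi.2 fun i => ?_
  have h := contDiffGroupoid n I |>.compatible (he i trivial) (he' i trivial)
  rw [contDiffGroupoid, mem_groupoid_of_pregroupoid] at h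
  have h1 : ContDiffOn ℝ n (I ∘ (e i).symm ≫ₕ e' i ∘ I.symm)
    (I.symm ⁻¹' ((e i).symm ≫ₕ e' i).source ∩ range I) := h.1
  refine ContDiffOn.comp (f := fun v : ι → E => v i) h1 (contDiff_apply ℝ E i).contDiffOn ?_
  rintro v ⟨hv1, hv2⟩
  refine ⟨?_, ?_⟩
  · have h1 := hv1.1 i trivial
    have h2 := hv1.2 i trivial
    exact ⟨h1, h2⟩
  · obtain ⟨w, rfl⟩ := hv2
    exact ⟨w i, rfl⟩

end PiManifold

/-! ### The pulled-back Maurer-Cartan form -/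

section MaurerCartan

variable {E : Type*} [NormedAddCommGroup E] [NormedSpace ℝ E] {H : Type*} [TopologicalSpace H]
  (I : ModelWithCorners ℝ E H) {G : Type*} [TopologicalSpace G] [ChartedSpace H G] [Group G]
  {D P : Type*} [NormedAddCommGroup D] [NormedSpace ℝ D] [NormedAddCommGroup P] [NormedSpace ℝ P]

/-- The pullback of the Maurer-Cartan form along a map `S : D → G`, in the preferred chart of `G`
at `1`: at `t` it is the derivative at `s = t` of `s ↦ S(t)⁻¹ S(s)`. -/
noncomputable def maurerCartan (S : D → G) (K : Set D) (t : D) : D →L[ℝ] E :=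
  fderivWithin ℝ (fun s => extChartAt I (1 : G) ((S t)⁻¹ * S s)) K t

theorem maurerCartan_congr {S S' : D → G} {K : Set D} (h : EqOn S S' K) {t : D} (ht : t ∈ K) :
    maurerCartan I S K t = maurerCartan I S' K t := by
  rw [maurerCartan, maurerCartan, h ht]
  exact fderivWithin_congr (fun s hs => by rw [h hs]) (by rw [h ht])

/-- The factor `g` cancels in `S(t)⁻¹ S(s)`. This gives homogeneity of the integral, and it allows
the normalization `S(t) = 1` in the structure equation. -/
theorem maurerCartan_mul_left (S : D → G) (K : Set D) (g : G) :
    maurerCartan I (fun t => g * S t) K = maurerCartan I S K := by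
  funext t
  simp only [maurerCartan]
  congr 1
  funext s
  rw [mul_inv_rev, mul_assoc, inv_mul_cancel_left]

variable [LieGroup I ∞ G]

/-- Where `S` and `T` agree, `S⁻¹ T` takes the value `1`, at which the chart is smooth. -/
theorem contMDiffWithinAt_extChartAt_inv_mul {S T : D → G} {K : Set D} {t : D}
    (hS : ContMDiffWithinAt 𝓘(ℝ, D) I ∞ S K t) (hT : ContMDiffWithinAt 𝓘(ℝ, D) I ∞ T K t)
    (h : S t = T t) :
    ContDiffWithinAt ℝ ∞ (fun s => extChartAt I (1 : G) ((S s)⁻¹ * T s)) K t := by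
  rw [← contMDiffWithinAt_iff_contDiffWithinAt]
  have h1 : ContMDiffWithinAt 𝓘(ℝ, D) I ∞ (fun s => (S s)⁻¹ * T s) K t := hS.inv.mul hT
  have h2 : ContMDiffAt I 𝓘(ℝ, E) ∞ (extChartAt I (1 : G)) ((S t)⁻¹ * T t) := by
    rw [h, inv_mul_cancel]; exact contMDiffAt_extChartAt
  exact h2.comp_contMDiffWithinAt t h1

/-- The base point `S(t)` moves with `t`, so the form is treated as a partial derivative in `s` of a
function of `((t, v), s)`, evaluated at `s = t`. The variable `v` is the parameter that later
describes the vertices. -/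
theorem contDiffOn_maurerCartan {K : Set D} (hK : UniqueDiffOn ℝ K) {U : Set P}
    {ψ : D × P → G} (hψ : ContMDiffOn 𝓘(ℝ, D × P) I ∞ ψ (K ×ˢ U)) :
    ContDiffOn ℝ ∞ (fun z : D × P => maurerCartan I (fun s => ψ (s, z.2)) K z.1) (K ×ˢ U) := by
  intro z hz
  refine ContDiffWithinAt.fderivWithin (n := ∞)
    (f := fun (z : D × P) (s : D) => extChartAt I (1 : G) ((ψ z)⁻¹ * ψ (s, z.2)))
    (g := Prod.fst) ?_ contDiffWithinAt_fst hK (by simp) hz fun w hw => hw.1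
  have h1 : ContMDiffWithinAt 𝓘(ℝ, (D × P) × D) I ∞ (fun w => ψ w.1) ((K ×ˢ U) ×ˢ K) (z, z.1) :=
    (hψ z hz).comp (z, z.1) contDiffWithinAt_fst.contMDiffWithinAt fun w hw => hw.1
  have h2 : ContMDiffWithinAt 𝓘(ℝ, (D × P) × D) I ∞ (fun w => ψ (w.2, w.1.2)) ((K ×ˢ U) ×ˢ K)
      (z, z.1) :=
    ContMDiffWithinAt.comp (t := K ×ˢ U) (z, z.1) (hψ z hz)
      (f := fun w : (D × P) × D => (w.2, w.1.2))
      (contDiff_snd.prodMk (contDiff_snd.comp contDiff_fst)).contDiffWithinAt.contMDiffWithinAt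
      fun w hw => ⟨hw.2, hw.1.2⟩
  exact contMDiffWithinAt_extChartAt_inv_mul I h1 h2 rfl

theorem contDiffOn_maurerCartan' {K : Set D} (hK : UniqueDiffOn ℝ K)
    {S : D → G} (hS : ContMDiffOn 𝓘(ℝ, D) I ∞ S K) :
    ContDiffOn ℝ ∞ (maurerCartan I S K) K := by
  have h := contDiffOn_maurerCartan (P := ℝ) I hK (U := univ) (ψ := fun z => S z.1)
    (hS.comp contDiff_fst.contMDiff.contMDiffOn fun w hw => hw.1)
  exact h.comp (contDiff_id.prodMk contDiff_const).contDiffOn (g := fun z : D × ℝ => _)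
    (f := fun t => (t, (0 : ℝ))) fun t ht => ⟨ht, trivial⟩

theorem maurerCartan_comp {D' : Type*} [NormedAddCommGroup D'] [NormedSpace ℝ D'] {K : Set D}
    {K' : Set D'} (hK' : UniqueDiffOn ℝ K') {S : D → G} (hS : ContMDiffOn 𝓘(ℝ, D) I ∞ S K)
    {ι : D' → D} (hι : Differentiable ℝ ι) (hm : MapsTo ι K' K) {t : D'} (ht : t ∈ K') (w : D') :
    maurerCartan I (S ∘ ι) K' t w = maurerCartan I S K (ι t) (fderiv ℝ ι t w) := by
  have h1 : DifferentiableWithinAt ℝ (fun s => extChartAt I (1 : G) ((S (ι t))⁻¹ * S s)) K (ι t) :=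
    (contMDiffWithinAt_extChartAt_inv_mul I (S := fun _ => S (ι t)) contMDiffWithinAt_const
      (hS _ (hm ht)) rfl).differentiableWithinAt (by simp)
  have h2 := (h1.hasFDerivWithinAt.comp t (hι t).hasFDerivAt.hasFDerivWithinAt hm).fderivWithin
    (hK' t ht)
  exact congrArg (fun L : D' →L[ℝ] E => L w) h2

/-- By the chain rule the left side is the derivative of `s ↦ S(t)⁻¹ S(s)`. Its value at `t` is `1`,
so `mfderivWithin` reads it in the preferred chart at `1`, exactly as `maurerCartan` does. -/
theorem mfderiv_inv_mul_mfderivWithin {K : Set D} (hK : UniqueDiffOn ℝ K) {S : D → G}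
    (hS : ContMDiffOn 𝓘(ℝ, D) I ∞ S K) {t : D} (ht : t ∈ K) (w : D) :
    mfderiv I I (fun x : G => (S t)⁻¹ * x) (S t) (mfderivWithin 𝓘(ℝ, D) I S K t w) =
      maurerCartan I S K t w := by
  have hSt := (hS t ht).mdifferentiableWithinAt (by simp)
  have hL : MDifferentiableAt I I (fun x : G => (S t)⁻¹ * x) (S t) :=
    (contMDiff_mul_left (I := I) (n := ∞) (a := (S t)⁻¹)).contMDiffAt.mdifferentiableAt (by simp)
  have hu : UniqueMDiffWithinAt 𝓘(ℝ, D) K t := (hK t ht).uniqueMDiffWithinAt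
  have h := mfderiv_comp_mfderivWithin t hL hSt hu
  have hc := hL.comp_mdifferentiableWithinAt t hSt
  have h' := congrArg (fun L : D →L[ℝ] E => L w) h
  refine h'.symm.trans ?_
  refine congrArg (fun L : D →L[ℝ] E => L w) (hc.mfderivWithin.trans ?_)
  simp only [maurerCartan, writtenInExtChartAt, extChartAt_model_space_eq_id, Function.comp_def,
    inv_mul_cancel]
  simp only [mfld_simps, PartialEquiv.refl_coe, preimage_id]
  rfl

theorem pullbackCoeff_leftInvariantForm [FiniteDimensional ℝ E] {p : ℕ}
    (η : LieCochain (GroupLieAlgebra I G) p) {S : (Fin (p + 1) → ℝ) → G}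
    (hS : ContMDiffOn 𝓘(ℝ, Fin p → ℝ) I ∞ (fun s => S (simplexCoord s)) (cornerSimplex p))
    {t : Fin p → ℝ} (ht : t ∈ cornerSimplex p) :
    pullbackCoeff I (leftInvariantForm I η) S t = η fun i =>
      maurerCartan I (fun s => S (simplexCoord s)) (cornerSimplex p) t
        (Pi.single i 1 : Fin p → ℝ) := by
  have h := fun i : Fin p => mfderiv_inv_mul_mfderivWithin I (uniqueDiffOn_cornerSimplex p) hS ht
    (Pi.single i 1)
  exact congrArg η (funext h)

end MaurerCartan

/-! ### The Lie bracket in a chart and the structure equation -/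

section StructureEquation

variable {E : Type*} [NormedAddCommGroup E] [NormedSpace ℝ E] {H : Type*} [TopologicalSpace H]
  (I : ModelWithCorners ℝ E H) (G : Type*) [TopologicalSpace G] [ChartedSpace H G] [Group G]

/-- The multiplication of `G` in the preferred chart at `1`. -/
noncomputable def chartMul (x y : E) : E :=
  extChartAt I (1 : G) ((extChartAt I (1 : G)).symm x * (extChartAt I (1 : G)).symm y)

/-- In the preferred chart at `1`, the derivative at `1` of the left translation by `x`. -/
noncomputable def chartLeftDeriv (x : E) : E →L[ℝ] E :=
  fderiv ℝ (chartMul I G x) (extChartAt I (1 : G) 1)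

variable [I.Boundaryless]

theorem chartTarget_mem_nhds :
    (extChartAt I (1 : G)).target ∈ 𝓝 (extChartAt I (1 : G) 1) :=
  extChartAt_target_mem_nhds (I := I) (1 : G)

theorem chartLeftDeriv_one :
    chartLeftDeriv I G (extChartAt I (1 : G) 1) = ContinuousLinearMap.id ℝ E := by
  have h : chartMul I G (extChartAt I (1 : G) 1) =ᶠ[𝓝 (extChartAt I (1 : G) 1)] id := by
    filter_upwards [chartTarget_mem_nhds I G] with y hy
    rw [chartMul, extChartAt_to_inv, one_mul, PartialEquiv.right_inv _ hy, id]
  rw [chartLeftDeriv, h.fderiv_eq, fderiv_id]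

variable [LieGroup I ∞ G]

theorem contDiffAt_chartMul :
    ContDiffAt ℝ ∞ (Function.uncurry (chartMul I G))
      (extChartAt I (1 : G) 1, extChartAt I (1 : G) 1) := by
  rw [← contMDiffAt_iff_contDiffAt]
  have hs : ContMDiffAt 𝓘(ℝ, E) I ∞ (extChartAt I (1 : G)).symm (extChartAt I (1 : G) 1) :=
    (contMDiffOn_extChartAt_symm (1 : G)).contMDiffAt (chartTarget_mem_nhds I G)
  have h1 : ContMDiffAt 𝓘(ℝ, E × E) I ∞ (fun z : E × E => (extChartAt I (1 : G)).symm z.1)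
      (extChartAt I (1 : G) 1, extChartAt I (1 : G) 1) :=
    ContMDiffAt.comp _ hs contDiffAt_fst.contMDiffAt
  have h2 : ContMDiffAt 𝓘(ℝ, E × E) I ∞ (fun z : E × E => (extChartAt I (1 : G)).symm z.2)
      (extChartAt I (1 : G) 1, extChartAt I (1 : G) 1) :=
    ContMDiffAt.comp _ hs contDiffAt_snd.contMDiffAt
  have h3 : ContMDiffAt I 𝓘(ℝ, E) ∞ (extChartAt I (1 : G))
      ((extChartAt I (1 : G)).symm (extChartAt I (1 : G) 1) *
        (extChartAt I (1 : G)).symm (extChartAt I (1 : G) 1)) := by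
    rw [extChartAt_to_inv, mul_one]; exact contMDiffAt_extChartAt
  exact ContMDiffAt.comp _ h3 (h1.mul h2)

theorem eventually_differentiableAt_chartMul :
    ∀ᶠ x in 𝓝 (extChartAt I (1 : G) 1),
      DifferentiableAt ℝ (chartMul I G x) (extChartAt I (1 : G) 1) := by
  have h := ((contDiffAt_chartMul I G).of_le (m := 1) (by simp)).eventually (by simp)
  have hc : ContinuousAt (fun x : E => (x, extChartAt I (1 : G) 1)) (extChartAt I (1 : G) 1) := by
    fun_prop
  filter_upwards [hc.eventually h] with x hx
  exact (hx.differentiableAt (by simp)).comp (extChartAt I (1 : G) 1)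
    (f := fun y : E => (x, y)) (by fun_prop)

theorem contDiffAt_chartLeftDeriv :
    ContDiffAt ℝ ∞ (chartLeftDeriv I G) (extChartAt I (1 : G) 1) :=
  ContDiffAt.fderiv (n := ∞) (contDiffAt_chartMul I G) contDiffAt_const (by simp)

/-- Pulling back along the inverse chart means applying the derivative of the chart; by the chain
rule this is the derivative at `1` of a left translation followed by the chart. -/
theorem mpullbackWithin_mulInvariantVectorField (v : GroupLieAlgebra I G) :
    VectorField.mpullbackWithin 𝓘(ℝ, E) I (extChartAt I (1 : G)).symm
        (mulInvariantVectorField v) (range I) =ᶠ[𝓝 (extChartAt I (1 : G) 1)]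
      fun x => chartLeftDeriv I G x v := by
  filter_upwards [chartTarget_mem_nhds I G] with x hx
  have : IsManifold I 1 G := IsManifold.of_le (n := ∞) (by simp)
  rw [VectorField.mpullbackWithin_apply, mulInvariantVectorField]
  have hinv : (mfderivWithin 𝓘(ℝ, E) I (extChartAt I (1 : G)).symm (range I) x).inverse =
      mfderiv I 𝓘(ℝ, E) (extChartAt I (1 : G)) ((extChartAt I (1 : G)).symm x) :=
    ContinuousLinearMap.inverse_eq (mfderivWithin_extChartAt_symm_comp_mfderiv_extChartAt hx)
      (mfderiv_extChartAt_comp_mfderivWithin_extChartAt_symm hx)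
  rw [hinv]
  set g := (extChartAt I (1 : G)).symm x with hg
  have hgs : g ∈ (extChartAt I (1 : G)).source := (extChartAt I (1 : G)).map_target hx
  have hL : MDifferentiableAt I I (fun y : G => g * y) 1 :=
    (contMDiff_mul_left (I := I) (n := ∞) (a := g)).contMDiffAt.mdifferentiableAt (by simp)
  have hc : MDifferentiableAt I 𝓘(ℝ, E) (extChartAt I (1 : G)) (g * 1) := by
    rw [mul_one]
    exact mdifferentiableAt_extChartAt (by simpa using hgs)
  have hcomp := mfderiv_comp (1 : G) hc hL
  have h1 := (hc.comp (1 : G) hL).mfderiv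
  rw [hcomp, I.range_eq_univ, fderivWithin_univ] at h1
  have h2 := congrArg (fun L : E →L[ℝ] E => L v) h1
  refine Eq.trans ?_ h2
  rw [mul_one]
  rfl

/-- In the chart the invariant fields are `x ↦ L(x) v` and `x ↦ L(x) w` with `L(1) = id`, and the
bracket of vector fields `V`, `W` on `E` is `DW(V) - DV(W)`. -/
theorem bracket_eq_chartLeftDeriv [CompleteSpace E] (v w : GroupLieAlgebra I G) :
    (⁅v, w⁆ : GroupLieAlgebra I G) =
      fderiv ℝ (chartLeftDeriv I G) (extChartAt I (1 : G) 1) v w -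
        fderiv ℝ (chartLeftDeriv I G) (extChartAt I (1 : G) 1) w v := by
  have : IsManifold I 1 G := IsManifold.of_le (n := ∞) (by simp)
  have hd : DifferentiableAt ℝ (chartLeftDeriv I G) (extChartAt I (1 : G) 1) :=
    (contDiffAt_chartLeftDeriv I G).differentiableAt (by simp)
  have hf : ∀ a b : E, fderiv ℝ (fun x => chartLeftDeriv I G x a) (extChartAt I (1 : G) 1) b =
      fderiv ℝ (chartLeftDeriv I G) (extChartAt I (1 : G) 1) b a := fun a b => by
    rw [(hd.hasFDerivAt.clm_apply (hasFDerivAt_const a _)).fderiv]; simp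
  have key : ∀ a b : E, VectorField.lieBracketWithin ℝ (fun x => chartLeftDeriv I G x a)
      (fun x => chartLeftDeriv I G x b) univ (extChartAt I (1 : G) 1) =
      fderiv ℝ (chartLeftDeriv I G) (extChartAt I (1 : G) 1) a b -
        fderiv ℝ (chartLeftDeriv I G) (extChartAt I (1 : G) 1) b a := fun a b => by
    simp only [VectorField.lieBracketWithin, fderivWithin_univ, hf, chartLeftDeriv_one,
      ContinuousLinearMap.id_apply]
  -- The preferred chart at `1` has the identity as its derivative at `1`, so bringing the bracket
  -- back from the chart changes nothing.
  have hid : ((mfderiv I 𝓘(ℝ, E) (extChartAt I (1 : G)) 1).inverse : E →L[ℝ] E) =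
      ContinuousLinearMap.id ℝ E :=
    (congrArg (ContinuousLinearMap.inverse (R := ℝ) (M := E) (M₂ := E))
      (mfderiv_extChartAt_self (I := I) (x := (1 : G)))).trans ContinuousLinearMap.inverse_id
  have h := Filter.EventuallyEq.lieBracketWithin_vectorField_eq_nhds (𝕜 := ℝ) (s := univ)
    (mpullbackWithin_mulInvariantVectorField I G v)
    (mpullbackWithin_mulInvariantVectorField I G w)
  rw [GroupLieAlgebra.bracket_def, VectorField.mlieBracket, VectorField.mlieBracketWithin_apply]
  refine (congrArg (fun L : E →L[ℝ] E => L _) hid).trans ?_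
  have hr : (extChartAt I (1 : G)).symm ⁻¹' univ ∩ range I = univ := by
    rw [preimage_univ, univ_inter, I.range_eq_univ]
  rw [hr]
  rw [ContinuousLinearMap.id_apply]
  exact h.trans (key v w)

variable {G} {D : Type*} [NormedAddCommGroup D] [NormedSpace ℝ D]

/-- Write `S(s) = S(t) · (S(t)⁻¹ S(s))` and differentiate at `s = t`. An identity on a neighbourhood
of `t₀` is needed, since it will be differentiated once more. -/
theorem fderiv_extChartAt_eq_chartLeftDeriv_comp {S : D → G} {K : Set D} (hKo : IsOpen K)
    (hS : ContMDiffOn 𝓘(ℝ, D) I ∞ S K) {t₀ : D} (ht₀ : t₀ ∈ K) (hS₀ : S t₀ = 1) :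
    fderiv ℝ (fun s => extChartAt I (1 : G) (S s)) =ᶠ[𝓝 t₀] fun t =>
      (chartLeftDeriv I G (extChartAt I (1 : G) (S t))).comp (maurerCartan I S K t) := by
  have hSc : ∀ t ∈ K, ContinuousAt S t := fun t ht =>
    (hS.continuousOn t ht).continuousAt (hKo.mem_nhds ht)
  have hsrc : ∀ᶠ t in 𝓝 t₀, S t ∈ (extChartAt I (1 : G)).source := by
    refine (hSc t₀ ht₀).eventually ?_
    rw [hS₀]; exact extChartAt_source_mem_nhds (1 : G)
  have hdiff : ∀ᶠ t in 𝓝 t₀, DifferentiableAt ℝ (chartMul I G (extChartAt I (1 : G) (S t)))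
      (extChartAt I (1 : G) 1) := by
    have hc : ContinuousAt (fun t => extChartAt I (1 : G) (S t)) t₀ := by
      refine ContinuousAt.comp (g := extChartAt I (1 : G)) ?_ (hSc t₀ ht₀)
      rw [hS₀]; exact continuousAt_extChartAt (1 : G)
    refine hc.eventually (p := fun x => DifferentiableAt ℝ (chartMul I G x)
      (extChartAt I (1 : G) 1)) ?_
    simp only [hS₀]; exact eventually_differentiableAt_chartMul I G
  filter_upwards [hKo.mem_nhds ht₀, hsrc, hdiff] with t ht hts htd
  set N : D → E := fun s => extChartAt I (1 : G) ((S t)⁻¹ * S s) with hN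
  have hNt : N t = extChartAt I (1 : G) 1 := by simp only [hN, inv_mul_cancel]
  have hNd : HasFDerivAt N (maurerCartan I S K t) t := by
    have := (contMDiffWithinAt_extChartAt_inv_mul I (S := fun _ => S t) contMDiffWithinAt_const
      (hS t ht) rfl).contDiffAt (hKo.mem_nhds ht)
    rw [maurerCartan, fderivWithin_of_isOpen hKo ht]
    exact (this.differentiableAt (by simp)).hasFDerivAt
  have heq : (fun s => extChartAt I (1 : G) (S s)) =ᶠ[𝓝 t]
      fun s => chartMul I G (extChartAt I (1 : G) (S t)) (N s) := by
    have hcont : ContinuousAt (fun s => (S t)⁻¹ * S s) t := by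
      have h1 : ContMDiffAt 𝓘(ℝ, D) I ∞ (fun s => (S t)⁻¹ * S s) t :=
        contMDiffAt_const.mul ((hS t ht).contMDiffAt (hKo.mem_nhds ht))
      exact h1.continuousAt
    have : ∀ᶠ s in 𝓝 t, (S t)⁻¹ * S s ∈ (extChartAt I (1 : G)).source := by
      refine hcont.eventually ?_
      simp only [inv_mul_cancel]; exact extChartAt_source_mem_nhds (1 : G)
    filter_upwards [this] with s hs
    rw [chartMul, hN, (extChartAt I (1 : G)).left_inv hs, (extChartAt I (1 : G)).left_inv hts,
      mul_inv_cancel_left]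
  rw [heq.fderiv_eq]
  rw [← hNt] at htd
  have := (htd.hasFDerivAt.comp t hNd).fderiv
  rw [hNt] at this
  exact this

/-- The Maurer-Cartan structure equation `dA(v, w) = -[A v, A w]`. -/
theorem maurerCartan_structure [CompleteSpace E] {S : D → G} {K : Set D} (hKo : IsOpen K)
    (hS : ContMDiffOn 𝓘(ℝ, D) I ∞ S K) {t : D} (ht : t ∈ K) (v w : D) :
    fderiv ℝ (maurerCartan I S K) t v w - fderiv ℝ (maurerCartan I S K) t w v =
      Bracket.bracket (L := GroupLieAlgebra I G) (M := GroupLieAlgebra I G)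
        (maurerCartan I S K t w) (maurerCartan I S K t v) := by
  -- Left translation does not affect `A`, and it brings `S` into the chart at `1`.
  wlog hS₀ : S t = 1 generalizing S with hwlog
  · have h := hwlog (S := fun s => (S t)⁻¹ * S s) (contMDiffOn_const.mul hS) (inv_mul_cancel _)
    rwa [maurerCartan_mul_left I S K (S t)⁻¹] at h
  set A := maurerCartan I S K with hA
  set u : D → E := fun s => extChartAt I (1 : G) (S s) with hu
  have hu1 : fderiv ℝ u =ᶠ[𝓝 t] fun s => (chartLeftDeriv I G (u s)).comp (A s) :=
    fderiv_extChartAt_eq_chartLeftDeriv_comp I hKo hS ht hS₀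
  have hut : u t = extChartAt I (1 : G) 1 := by simp only [hu, hS₀]
  have hus : ContDiffAt ℝ ∞ u t := by
    rw [← contMDiffAt_iff_contDiffAt]
    refine ContMDiffAt.comp (I' := I) t ?_ ((hS t ht).contMDiffAt (hKo.mem_nhds ht))
    rw [hS₀]; exact contMDiffAt_extChartAt
  have hAd : HasFDerivAt A (fderiv ℝ A t) t :=
    (((contDiffOn_maurerCartan' I hKo.uniqueDiffOn hS).contDiffAt
      (hKo.mem_nhds ht)).differentiableAt (by simp)).hasFDerivAt
  have hLd := ((contDiffAt_chartLeftDeriv I G).differentiableAt (by simp)).hasFDerivAt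
  have hut' : fderiv ℝ u t = A t := by
    simp only [hu1.self_of_nhds, hut, chartLeftDeriv_one, ContinuousLinearMap.id_comp]
  rw [← hut] at hLd
  have hcomp := (hLd.comp t (hus.differentiableAt (by simp)).hasFDerivAt).clm_comp hAd
  -- Product rule for `du = L(u) ∘ A` at a point where `L(u) = id` and `du = A`. Symmetry of the
  -- left side in `a` and `b` is the structure equation.
  have hsecond : ∀ a b : D, fderiv ℝ (fderiv ℝ u) t a b =
      fderiv ℝ A t a b + fderiv ℝ (chartLeftDeriv I G) (extChartAt I (1 : G) 1) (A t a) (A t b) := by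
    intro a b
    rw [hu1.fderiv_eq]
    have h := congrArg (fun L : D →L[ℝ] D →L[ℝ] E => L a b) hcomp.fderiv
    refine h.trans ?_
    simp [hut, chartLeftDeriv_one, hut', -extChartAt]
  have hsymm := hus.isSymmSndFDerivAt (by
    rw [minSmoothness_of_isRCLikeNormedField]; exact ENat.LEInfty.out) v w
  rw [hsecond, hsecond] at hsymm
  refine Eq.trans ?_ (bracket_eq_chartLeftDeriv I G _ _).symm
  rw [sub_eq_sub_iff_add_eq_add, hsymm, add_comm]

end StructureEquation

/-! ### The faces of the simplex in coordinates -/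

section FaceDerivatives

theorem fderiv_pi_apply {D ι : Type*} [NormedAddCommGroup D] [NormedSpace ℝ D] [Fintype ι]
    {F : D → ι → ℝ} {t : D} (hF : DifferentiableAt ℝ F t) (w : D) (i : ι) :
    fderiv ℝ F t w i = fderiv ℝ (fun s => F s i) t w := by
  rw [(hasFDerivAt_pi'.1 hF.hasFDerivAt i).fderiv]; rfl

theorem fderiv_simplexCoord {p : ℕ} (t : Fin p → ℝ) (k : Fin p) :
    fderiv ℝ simplexCoord t (Pi.single k 1) =
      (Pi.single k.succ 1 - Pi.single 0 1 : Fin (p + 1) → ℝ) := by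
  funext i
  rw [fderiv_pi_apply ((contDiff_simplexCoord p (n := 1)).differentiable one_ne_zero t)]
  refine Fin.cases ?_ (fun j => ?_) i
  · have h : HasFDerivAt (fun s : Fin p → ℝ => simplexCoord s 0)
        (-∑ i, ContinuousLinearMap.proj (R := ℝ) i : (Fin p → ℝ) →L[ℝ] ℝ) t := by
      simp only [simplexCoord, Fin.cons_zero]
      exact (HasFDerivAt.fun_sum fun i _ => hasFDerivAt_apply i t).const_sub 1
    rw [h.fderiv]
    simp
  · have h : HasFDerivAt (fun s : Fin p → ℝ => simplexCoord s j.succ)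
        (ContinuousLinearMap.proj (R := ℝ) j : (Fin p → ℝ) →L[ℝ] ℝ) t := by
      simp only [simplexCoord, Fin.cons_succ]
      exact hasFDerivAt_apply j t
    rw [h.fderiv]
    simp [Pi.single_apply]

theorem fderiv_insertNth {p : ℕ} (j : Fin (p + 1)) (c : ℝ) (t : Fin p → ℝ) (k : Fin p) :
    fderiv ℝ (fun y : Fin p → ℝ => j.insertNth (α := fun _ => ℝ) c y) t (Pi.single k 1) =
      Pi.single (j.succAbove k) 1 := by
  funext i
  rw [fderiv_pi_apply ((contDiff_insertNth j c (n := 1)).differentiable one_ne_zero t)]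
  rcases Fin.eq_self_or_eq_succAbove j i with rfl | ⟨l, rfl⟩
  · simp
  · simp only [Fin.insertNth_apply_succAbove]
    rw [(hasFDerivAt_apply l t).fderiv]
    simp [Pi.single_apply]

/-- The coordinate face `t_j = 0` is face `j + 1` of the standard simplex: barycentric coordinate
`0` is the extra one. -/
theorem simplexCoord_insertNth {p : ℕ} (j : Fin (p + 1)) (t : Fin p → ℝ) :
    simplexCoord (j.insertNth (α := fun _ => ℝ) 0 t) =
      j.succ.insertNth (α := fun _ => ℝ) 0 (simplexCoord t) := by
  funext i
  refine Fin.cases ?_ (fun i => ?_) i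
  · rw [← Fin.succ_succAbove_zero j, Fin.insertNth_apply_succAbove, Fin.succ_succAbove_zero]
    simp [simplexCoord, Fin.sum_univ_succAbove _ j]
  · rcases Fin.eq_self_or_eq_succAbove j i with rfl | ⟨l, rfl⟩
    · simp [simplexCoord]
    · rw [← Fin.succ_succAbove_succ, Fin.insertNth_apply_succAbove]
      simp [simplexCoord]

/-- On the slanted face barycentric coordinate `0` vanishes, so this is face `0`. -/
theorem simplexCoord_simplexCoord {p : ℕ} (t : Fin p → ℝ) :
    simplexCoord (simplexCoord t) =
      (0 : Fin (p + 2)).insertNth (α := fun _ => ℝ) 0 (simplexCoord t) := by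
  rw [Fin.insertNth_zero']
  conv_lhs => rw [simplexCoord, sum_simplexCoord, sub_self]

end FaceDerivatives

/-! ### The integration map and Stokes' theorem -/

section Integration

variable {E : Type*} [NormedAddCommGroup E] [NormedSpace ℝ E]
  {H : Type*} [TopologicalSpace H] (I : ModelWithCorners ℝ E H)

theorem boundaryless_pi {ι : Type*} [Fintype ι] [I.Boundaryless] :
    (ModelWithCorners.pi fun _ : ι => I).Boundaryless := by
  refine ⟨?_⟩
  change range (fun (v : ι → H) i => I (v i)) = univ
  refine eq_univ_of_forall fun v => ⟨fun i => I.symm (v i), funext fun i => ?_⟩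
  exact I.right_inv (by rw [I.range_eq_univ]; trivial)

variable {G : Type*} [TopologicalSpace G] [ChartedSpace H G] [Group G]
  {I} (Φ : LeftInvariantSimplices I G)

/-- Letting the vertices depend on a parameter in a vector space makes calculus on `ℝ^p × P`
applicable; `γ` will be an inverse chart of `G^{p+1}`. -/
theorem LeftInvariantSimplices.contMDiffOn_family {P : Type*} [NormedAddCommGroup P]
    [NormedSpace ℝ P] (p : ℕ) {γ : P → Fin (p + 1) → G} {U : Set P}
    (hγ : ContMDiffOn 𝓘(ℝ, P) (ModelWithCorners.pi fun _ : Fin (p + 1) => I) ∞ γ U) :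
    ContMDiffOn 𝓘(ℝ, (Fin p → ℝ) × P) I ∞
      (fun z : (Fin p → ℝ) × P => Φ.φ p (simplexCoord z.1) (γ z.2)) (cornerSimplex p ×ˢ U) := by
  have h1 : ContMDiffOn 𝓘(ℝ, (Fin p → ℝ) × P) 𝓘(ℝ, Fin (p + 1) → ℝ) ∞
      (fun z : (Fin p → ℝ) × P => simplexCoord z.1) (cornerSimplex p ×ˢ U) :=
    ((contDiff_simplexCoord p).comp contDiff_fst).contMDiff.contMDiffOn
  have h2 : ContMDiffOn 𝓘(ℝ, (Fin p → ℝ) × P) (ModelWithCorners.pi fun _ : Fin (p + 1) => I) ∞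
      (fun z : (Fin p → ℝ) × P => γ z.2) (cornerSimplex p ×ˢ U) :=
    hγ.comp contDiff_snd.contMDiff.contMDiffOn fun z hz => hz.2
  exact (Φ.smooth p).comp (h1.prodMk h2) fun z hz => ⟨simplexCoord_mem_stdSimplex hz.1, trivial⟩

theorem LeftInvariantSimplices.contMDiffOn_simplex (p : ℕ) (g : Fin (p + 1) → G) :
    ContMDiffOn 𝓘(ℝ, Fin p → ℝ) I ∞ (fun s => Φ.φ p (simplexCoord s) g) (cornerSimplex p) :=
  (Φ.contMDiffOn_family p (P := ℝ) (γ := fun _ => g) (U := univ) contMDiffOn_const).comp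
    (contDiff_id.prodMk contDiff_const).contMDiff.contMDiffOn (f := fun s => (s, (0 : ℝ)))
    fun _ hs => ⟨hs, trivial⟩

variable [FiniteDimensional ℝ E] [LieGroup I ∞ G]

theorem contDiffOn_alternating_maurerCartan {P : Type*} [NormedAddCommGroup P] [NormedSpace ℝ P]
    {p q : ℕ} (η : E [⋀^Fin p]→ₗ[ℝ] ℝ) {U : Set P} {ψ : (Fin q → ℝ) × P → G}
    (hψ : ContMDiffOn 𝓘(ℝ, (Fin q → ℝ) × P) I ∞ ψ (cornerSimplex q ×ˢ U))
    (e : Fin p → Fin q → ℝ) :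
    ContDiffOn ℝ ∞ (fun z => η fun i =>
      maurerCartan I (fun s => ψ (s, z.2)) (cornerSimplex q) z.1 (e i)) (cornerSimplex q ×ˢ U) :=
  η.contDiff.comp_contDiffOn <| contDiffOn_pi.2 fun _ =>
    (contDiffOn_maurerCartan I (uniqueDiffOn_cornerSimplex q) hψ).clm_apply contDiffOn_const

theorem contDiffOn_alternating_maurerCartan' {p q : ℕ} (η : E [⋀^Fin p]→ₗ[ℝ] ℝ)
    {S : (Fin q → ℝ) → G} (hS : ContMDiffOn 𝓘(ℝ, Fin q → ℝ) I ∞ S (cornerSimplex q))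
    (e : Fin p → Fin q → ℝ) :
    ContDiffOn ℝ ∞ (fun t => η fun i => maurerCartan I S (cornerSimplex q) t (e i))
      (cornerSimplex q) :=
  η.contDiff.comp_contDiffOn <| contDiffOn_pi.2 fun _ =>
    (contDiffOn_maurerCartan' I (uniqueDiffOn_cornerSimplex q) hS).clm_apply contDiffOn_const

theorem simplexIntegral_leftInvariantForm {p : ℕ} (η : LieCochain (GroupLieAlgebra I G) p)
    (g : Fin (p + 1) → G) :
    simplexIntegral I (leftInvariantForm I η) (fun x => Φ.φ p x g) =
      ∫ t in cornerSimplex p, η fun i =>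
        maurerCartan I (fun s => Φ.φ p (simplexCoord s) g) (cornerSimplex p) t
          (Pi.single i 1 : Fin p → ℝ) :=
  setIntegral_congr_fun (measurableSet_cornerSimplex p) fun _ ht =>
    pullbackCoeff_leftInvariantForm I η (Φ.contMDiffOn_simplex p g) ht

theorem integrableOn_pullbackCoeff {p : ℕ} (η : LieCochain (GroupLieAlgebra I G) p)
    (g : Fin (p + 1) → G) :
    IntegrableOn (pullbackCoeff I (leftInvariantForm I η) (fun x => Φ.φ p x g))
      (cornerSimplex p) := by
  have hc := (contDiffOn_alternating_maurerCartan' (I := I) (G := G) η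
    (Φ.contMDiffOn_simplex p g) (fun i => Pi.single i 1)).continuousOn
  exact (hc.congr fun t ht => pullbackCoeff_leftInvariantForm I η (Φ.contMDiffOn_simplex p g)
    ht).integrableOn_compact (isCompact_cornerSimplex p)

/-- In a product chart around `g₀` this is an integral over a fixed compact set with a smooth
parameter. Absence of boundary makes the chart target open. -/
theorem contMDiff_simplexIntegral [I.Boundaryless] {p : ℕ}
    (η : LieCochain (GroupLieAlgebra I G) p) :
    ContMDiff (ModelWithCorners.pi fun _ : Fin (p + 1) => I) 𝓘(ℝ, ℝ) ∞
      fun g : Fin (p + 1) → G =>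
        simplexIntegral I (leftInvariantForm I η) (fun x => Φ.φ p x g) := by
  intro g₀
  have : IsManifold (ModelWithCorners.pi fun _ : Fin (p + 1) => I) ∞ (Fin (p + 1) → G) :=
    isManifold_pi I ∞ G
  have := boundaryless_pi (ι := Fin (p + 1)) I
  set c := extChartAt (ModelWithCorners.pi fun _ : Fin (p + 1) => I) g₀ with hc
  have hγ : ContMDiffOn 𝓘(ℝ, Fin (p + 1) → E) (ModelWithCorners.pi fun _ : Fin (p + 1) => I) ∞
      c.symm c.target := contMDiffOn_extChartAt_symm g₀
  have h1 : ContDiffOn ℝ ∞ (fun v => ∫ t in cornerSimplex p, η fun i =>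
      maurerCartan I (fun s => Φ.φ p (simplexCoord s) (c.symm v)) (cornerSimplex p) t
        (Pi.single i 1 : Fin p → ℝ)) c.target :=
    contDiffOn_setIntegral (isCompact_cornerSimplex p) (uniqueDiffOn_cornerSimplex p)
      (isOpen_extChartAt_target g₀)
      (contDiffOn_alternating_maurerCartan (I := I) (G := G) η (Φ.contMDiffOn_family p hγ)
        (fun i => Pi.single i 1))
  have h2 := (h1.contDiffAt (extChartAt_target_mem_nhds g₀)).contMDiffAt.comp g₀
    (contMDiffAt_extChartAt (I := ModelWithCorners.pi fun _ : Fin (p + 1) => I) (n := ∞))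
  refine h2.congr_of_eventuallyEq ?_
  filter_upwards [extChartAt_source_mem_nhds
    (I := ModelWithCorners.pi fun _ : Fin (p + 1) => I) g₀] with g hg
  rw [simplexIntegral_leftInvariantForm, Function.comp_apply]
  simp only [← hc, c.left_inv hg]

theorem simplexIntegral_mul_left {p : ℕ} (η : LieCochain (GroupLieAlgebra I G) p) (h : G)
    (g : Fin (p + 1) → G) :
    simplexIntegral I (leftInvariantForm I η) (fun x => Φ.φ p x fun i => h * g i) =
      simplexIntegral I (leftInvariantForm I η) (fun x => Φ.φ p x g) := by
  rw [simplexIntegral_leftInvariantForm, simplexIntegral_leftInvariantForm]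
  refine setIntegral_congr_fun (measurableSet_cornerSimplex p) fun t ht => ?_
  have hEq : EqOn (fun s => Φ.φ p (simplexCoord s) fun i => h * g i)
      (fun s => h * Φ.φ p (simplexCoord s) g) (cornerSimplex p) := fun s hs =>
    (Φ.left_invariant p h g _ (simplexCoord_mem_stdSimplex hs)).symm
  simp only [maurerCartan_congr I hEq ht, maurerCartan_mul_left]

/-- The integration map on cochains. -/
noncomputable def integrationMap [I.Boundaryless] (p : ℕ) :
    LieCochain (GroupLieAlgebra I G) p →ₗ[ℝ] groupCochain I G p where
  toFun η := ⟨fun g => simplexIntegral I (leftInvariantForm I η) (fun x => Φ.φ p x g),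
    contMDiff_simplexIntegral Φ η, simplexIntegral_mul_left Φ η⟩
  map_add' η θ := by
    ext g
    exact integral_add (integrableOn_pullbackCoeff Φ η g) (integrableOn_pullbackCoeff Φ θ g)
  map_smul' c η := by
    ext g
    exact integral_const_mul c _

/-- The integrand of Stokes' theorem for a left-invariant form, in the interior of the simplex. -/
theorem lieD_maurerCartan_eq_sum [I.Boundaryless] {p : ℕ} (η : LieCochain (GroupLieAlgebra I G) p)
    {S : (Fin (p + 1) → ℝ) → G}
    (hS : ContMDiffOn 𝓘(ℝ, Fin (p + 1) → ℝ) I ∞ S (cornerSimplex (p + 1)))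
    {t : Fin (p + 1) → ℝ} (ht : t ∈ interior (cornerSimplex (p + 1))) :
    lieD (GroupLieAlgebra I G) p η (fun i => maurerCartan I S (cornerSimplex (p + 1)) t
        (Pi.single i 1 : Fin (p + 1) → ℝ)) =
      ∑ j : Fin (p + 1), (-1) ^ (j : ℕ) * fderivWithin ℝ (fun s => η fun k =>
        maurerCartan I S (cornerSimplex (p + 1)) s
          (Pi.single (j.succAbove k) 1 : Fin (p + 1) → ℝ)) (cornerSimplex (p + 1)) t
        (Pi.single j 1 : Fin (p + 1) → ℝ) := by
  set K := cornerSimplex (p + 1) with hK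
  set A := maurerCartan I S K with hA
  have hKt : K ∈ 𝓝 t := mem_interior_iff_mem_nhds.1 ht
  have hAd : DifferentiableAt ℝ A t :=
    ((contDiffOn_maurerCartan' I (uniqueDiffOn_cornerSimplex _) hS).contDiffAt
      hKt).differentiableAt (by simp)
  -- The structure equation is available on open sets only, and near `t` the derivatives within `K`
  -- and within its interior agree.
  have hAe : maurerCartan I S (interior K) =ᶠ[𝓝 t] A := by
    filter_upwards [isOpen_interior.mem_nhds ht] with s hs
    rw [hA, maurerCartan, maurerCartan, fderivWithin_of_isOpen isOpen_interior hs,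
      fderivWithin_of_mem_nhds (mem_interior_iff_mem_nhds.1 hs)]
  have hstr : ∀ i j : Fin (p + 1),
      fderiv ℝ A t (Pi.single j 1) (Pi.single i 1) - fderiv ℝ A t (Pi.single i 1) (Pi.single j 1) =
        Bracket.bracket (L := GroupLieAlgebra I G) (M := GroupLieAlgebra I G)
          (A t (Pi.single i 1)) (A t (Pi.single j 1)) := by
    intro i j
    have h := maurerCartan_structure I isOpen_interior (hS.mono interior_subset) ht
      (Pi.single j 1) (Pi.single i 1)
    rwa [hAe.fderiv_eq, hAe.self_of_nhds] at h
  have hAe' : ∀ e w : Fin (p + 1) → ℝ, DifferentiableAt ℝ (fun s => A s e) t ∧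
      fderiv ℝ (fun s => A s e) t w = fderiv ℝ A t w e := by
    intro e w
    have h := hAd.hasFDerivAt.clm_apply (hasFDerivAt_const e t)
    refine ⟨h.differentiableAt, ?_⟩
    rw [h.fderiv]; simp
  have hterm : ∀ j : Fin (p + 1), fderivWithin ℝ (fun s => η fun k =>
      A s (Pi.single (j.succAbove k) 1 : Fin (p + 1) → ℝ)) K t (Pi.single j 1) =
      ∑ k : Fin p, η (Function.update
        (j.removeNth fun i => A t (Pi.single i 1 : Fin (p + 1) → ℝ)) k
        (fderiv ℝ A t (Pi.single j 1) (Pi.single (j.succAbove k) 1))) := by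
    intro j
    rw [fderivWithin_of_mem_nhds hKt]
    have h := AlternatingMap.fderiv_comp (E := E) η
      (a := fun k s => A s (Pi.single (j.succAbove k) 1 : Fin (p + 1) → ℝ)) (t := t)
      (fun k => (hAe' _ 0).1) (Pi.single j 1)
    refine h.trans (Finset.sum_congr rfl fun k _ => ?_)
    simp only [(hAe' _ _).2]
    rfl
  refine (lieD_apply (L := GroupLieAlgebra I G) η _).trans ?_
  simp only [hterm]
  -- With `B i j = ∂_i (A e_j)`, the differences `B j i - B i j` are the brackets `[A e_i, A e_j]`.
  have h := sum_alternating_update_removeNth (V := E) η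
    (fun i => A t (Pi.single i 1 : Fin (p + 1) → ℝ))
    (fun i j => fderiv ℝ A t (Pi.single i 1) (Pi.single j 1))
  simp only [hstr] at h
  exact h.symm

/-- Stokes' theorem for left-invariant forms on simplices. -/
theorem simplexIntegral_lieD [I.Boundaryless] {p : ℕ} (η : LieCochain (GroupLieAlgebra I G) p)
    (g : Fin (p + 2) → G) :
    simplexIntegral I (leftInvariantForm I (lieD (GroupLieAlgebra I G) p η))
        (fun x => Φ.φ (p + 1) x g) =
      ∑ i : Fin (p + 2), (-1) ^ (i : ℕ) *
        simplexIntegral I (leftInvariantForm I η) (fun x => Φ.φ p x (g ∘ i.succAbove)) := by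
  set K := cornerSimplex (p + 1) with hK
  set S : (Fin (p + 1) → ℝ) → G := fun s => Φ.φ (p + 1) (simplexCoord s) g with hSdef
  have hS : ContMDiffOn 𝓘(ℝ, Fin (p + 1) → ℝ) I ∞ S K := Φ.contMDiffOn_simplex (p + 1) g
  set f : Fin (p + 1) → (Fin (p + 1) → ℝ) → ℝ := fun j s => η fun k =>
    maurerCartan I S K s (Pi.single (j.succAbove k) 1 : Fin (p + 1) → ℝ) with hf
  have hfc : ∀ j, ContDiffOn ℝ 1 (f j) K := fun j =>
    (contDiffOn_alternating_maurerCartan' (I := I) (G := G) η hS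
      fun k => Pi.single (j.succAbove k) 1).of_le (by simp)
  -- Any parametrization `ι` of the `i`th face computes its integral: the face axiom identifies the
  -- small simplex with `S ∘ ι`, and `A` pulls back along `ι` by the chain rule.
  have hface : ∀ (i : Fin (p + 2)) (ι : (Fin p → ℝ) → Fin (p + 1) → ℝ), Differentiable ℝ ι →
      MapsTo ι (cornerSimplex p) K →
      (∀ t, simplexCoord (ι t) = i.insertNth (α := fun _ => ℝ) 0 (simplexCoord t)) →
      simplexIntegral I (leftInvariantForm I η) (fun x => Φ.φ p x (g ∘ i.succAbove)) =
        ∫ t in cornerSimplex p, η fun k =>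
          maurerCartan I S K (ι t) (fderiv ℝ ι t (Pi.single k 1)) := by
    intro i ι hι hm hcoord
    rw [simplexIntegral_leftInvariantForm]
    refine setIntegral_congr_fun (measurableSet_cornerSimplex p) fun t ht => ?_
    have hEq : EqOn (fun s => Φ.φ p (simplexCoord s) (g ∘ i.succAbove)) (S ∘ ι)
        (cornerSimplex p) := fun s hs => by
      rw [Function.comp_apply, hSdef]
      simp only [hcoord]
      exact (Φ.face p g i _ (simplexCoord_mem_stdSimplex hs)).symm
    refine congrArg η (funext fun k => ?_)
    rw [maurerCartan_congr I hEq ht]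
    exact maurerCartan_comp I (uniqueDiffOn_cornerSimplex p) hS hι hm ht _
  have hmaps : ∀ j : Fin (p + 1),
      MapsTo (fun t => j.insertNth (α := fun _ => ℝ) 0 t) (cornerSimplex p) K := fun j t ht =>
    (insertNth_mem_cornerSimplex_iff j 0 t).2 ⟨ht, le_rfl, by simpa using ht.2⟩
  have hface0 : simplexIntegral I (leftInvariantForm I η)
      (fun x => Φ.φ p x (g ∘ (0 : Fin (p + 2)).succAbove)) =
        ∑ j : Fin (p + 1), (-1) ^ (j : ℕ) * ∫ t in cornerSimplex p, f j (simplexCoord t) := by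
    rw [hface 0 simplexCoord ((contDiff_simplexCoord p (n := 1)).differentiable one_ne_zero)
      (fun t ht => simplexCoord_mem_cornerSimplex ht) simplexCoord_simplexCoord]
    simp only [← integral_const_mul]
    rw [← integral_finsetSum]
    · refine setIntegral_congr_fun (measurableSet_cornerSimplex p) fun t _ => ?_
      simp only [fderiv_simplexCoord, map_sub]
      exact alternating_sub_zero_eq_sum (V := E) η
        fun i => maurerCartan I S K (simplexCoord t) (Pi.single i 1 : Fin (p + 1) → ℝ)
    · intro j _
      refine Integrable.const_mul (ContinuousOn.integrableOn_compact (isCompact_cornerSimplex p)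
        ((hfc j).continuousOn.comp (contDiff_simplexCoord p (n := 0)).continuous.continuousOn
          fun t ht => simplexCoord_mem_cornerSimplex ht)) _
  have hfaceS : ∀ j : Fin (p + 1), simplexIntegral I (leftInvariantForm I η)
      (fun x => Φ.φ p x (g ∘ j.succ.succAbove)) =
        ∫ t in cornerSimplex p, f j (j.insertNth (α := fun _ => ℝ) 0 t) := by
    intro j
    rw [hface j.succ (fun t => j.insertNth (α := fun _ => ℝ) 0 t)
      ((contDiff_insertNth j 0 (n := 1)).differentiable one_ne_zero) (hmaps j)
      (simplexCoord_insertNth j)]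
    simp only [fderiv_insertNth]
    rfl
  have h_int : ∀ j : Fin (p + 1),
      IntegrableOn (fun t => fderivWithin ℝ (f j) K t (Pi.single j 1)) K := fun j =>
    (continuousOn_fderivWithin_cornerSimplex (hfc j) _).integrableOn_compact
      (isCompact_cornerSimplex _)
  -- The boundary of a convex set is null, so the pointwise identity for `dη` is needed only in the
  -- interior.
  have hinterior : ∀ᵐ t ∂(volume.restrict K), t ∈ interior K := by
    rw [ae_restrict_iff' (measurableSet_cornerSimplex _)]
    have h0 := (convex_cornerSimplex (p + 1)).addHaar_frontier volume
    filter_upwards [measure_eq_zero_iff_ae_notMem.1 h0] with t ht htK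
    by_contra hti
    exact ht ⟨subset_closure htK, hti⟩
  rw [simplexIntegral_leftInvariantForm]
  have hcongr : (fun t => lieD (GroupLieAlgebra I G) p η fun i => maurerCartan I S K t
      (Pi.single i 1 : Fin (p + 1) → ℝ)) =ᵐ[volume.restrict K]
        fun t => ∑ j : Fin (p + 1), (-1) ^ (j : ℕ) * fderivWithin ℝ (f j) K t (Pi.single j 1) := by
    filter_upwards [hinterior] with t ht using lieD_maurerCartan_eq_sum η hS ht
  rw [integral_congr_ae hcongr, integral_finsetSum _ fun j _ => (h_int j).const_mul _,
    Fin.sum_univ_succ (n := p + 1), hface0]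
  have hdir : ∀ j : Fin (p + 1), ∫ t in K, fderivWithin ℝ (f j) K t (Pi.single j 1) =
      (∫ t in cornerSimplex p, f j (simplexCoord t)) -
        ∫ t in cornerSimplex p, f j (j.insertNth (α := fun _ => ℝ) 0 t) := fun j =>
    setIntegral_fderivWithin_cornerSimplex (hfc j) j
  simp only [integral_const_mul, hdir, hfaceS]
  rw [Fin.val_zero, pow_zero, one_mul, ← Finset.sum_add_distrib]
  refine Finset.sum_congr rfl fun j _ => ?_
  -- The minus sign of the face `t_j = 0` is the extra factor in `(-1)^(j+1)`.
  rw [Fin.val_succ, pow_succ]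
  ring

end Integration

theorem mainTheorem3 {E : Type*} [NormedAddCommGroup E] [NormedSpace ℝ E] [FiniteDimensional ℝ E]
    {H : Type*} [TopologicalSpace H] (I : ModelWithCorners ℝ E H) [I.Boundaryless]
    {G : Type*} [TopologicalSpace G] [ChartedSpace H G] [Group G] [LieGroup I ∞ G]
    (Φ : LeftInvariantSimplices I G) :
    ∃ J : ∀ p : ℕ, LieCochain (GroupLieAlgebra I G) p →ₗ[ℝ] groupCochain I G p,
      (∀ (p : ℕ) (η : LieCochain (GroupLieAlgebra I G) p) (g : Fin (p + 1) → G),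
        MeasureTheory.IntegrableOn
            (pullbackCoeff I (leftInvariantForm I η) (fun x => Φ.φ p x g)) (cornerSimplex p) ∧
          (J p η).1 g = simplexIntegral I (leftInvariantForm I η) (fun x => Φ.φ p x g)) ∧
      ∀ p : ℕ, J (p + 1) ∘ₗ lieD (GroupLieAlgebra I G) p = groupD I G p ∘ₗ J p := by
  refine ⟨integrationMap Φ, fun p η g => ⟨integrableOn_pullbackCoeff Φ η g, rfl⟩, fun p => ?_⟩
  ext η g
  exact simplexIntegral_lieD Φ η g
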